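/- **Conventions.** All locally convex spaces are real or complex and Hausdorff. Let $E,F$ be locally convex spaces and let $U\subseteq E$ have dense interior. A map $f\colon U\to F$ is $C^1$ if it is continuous, if the limit $df(x).v=\lim_{h\to 0}\frac1h\,(f(x+hv)-f(x))$ ($h$ real) exists for all $x\in\operatorname{int}U$ and $v\in E$, and if $(x,v)\mapsto df(x).v$ extends to a continuous map $df\colon U\times E\to F$. It is *smooth* if the higher differentials $d^0f=f$, $d^{n+1}f=d(d^nf)\colon U\times E^{2^{n+1}-1}\to F$ exist for all $n$. If $E,F$ are complex, a smooth map $f$ is *holomorphic* if $df(x)\colon E\to F$ is complex linear for all $x\in\operatorname{int}U$. A *smooth manifold with corners* is a Hausdorff space $M$ with charts (homeomorphisms $\varphi$ from open subsets of $M$ onto relatively open subsets of $X^+=\{x\in X:\lambda_1(x)\ge 0,\dots,\lambda_k(x)\ge 0\}$) that cover $M$ and whose coordinate changes are smooth; here $X$ is a locally convex space and $\lambda_1,\dots,\lambda_k$ are continuous linear functionals on $X$ such that $X^+$ has dense interior. A map from $M$ to $F$, or from $M\times U$ to $F$ with $U\subseteq E$ open, is smooth if its coordinate representations with respect to the charts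 $\varphi$ of $M$ (respectively $\varphi\times\operatorname{id}_U$ of $M\times U$) are smooth. The space $C^\infty(M,F)$ of smooth maps carries the topology of compact convergence of all differentials $d^n\gamma$ on $T^nM$, i.e. the initial topology with respect to the maps $\gamma\mapsto d^n(\gamma\circ\varphi^{-1})\in C(\varphi(U_\varphi)\times X^{2^n-1},F)$ for all charts $\varphi$ (with domain $U_\varphi$) and all $n\ge 0$, where the spaces $C(\cdot,F)$ carry the compact-open topology. Put $C^\infty(M,U)=\{\gamma\in C^\infty(M,E):\gamma(M)\subseteq U\}$. **Proposition.** Let $M$ be a compact smooth manifold with corners, let $E$ and $F$ be locally convex spaces and let $U\subseteq E$ be open. Then $C^\infty(M,U)$ is open in $C^\infty(M,E)$. If $f\colon M\times U\to F$ is smooth, then $f\circ(\operatorname{id}_M,\gamma)$ is smooth for each $\gamma\in C^\infty(M,U)$, and the map $$f_\sharp\colon C^\infty(M,U)\to C^\infty(M,F),\qquad \gamma\mapsto f\circ(\operatorname{id}_M,\gamma),$$ is smooth. For all $n\in\mathbb N_0$ its $n$-th differential is $d^n(f_\sharp)=(d_2^nf)_\sharp$, that is, $$d^n(f_\sharp)(w)(x)=d_2^nf\big(x,w(x)\big)\qquad\text{for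 } w\in C^\infty(M,U)\times C^\infty(M,E)^{2^n-1},\ x\in M,$$ where $w(x)\in U\times E^{2^n-1}$ is obtained by evaluating each component at $x$, and where $d_2^nf\colon M\times(U\times E^{2^n-1})\to F$ is the $n$-th differential of $f$ with all tangent directions along $M$ equal to zero: $d_2^nf(x,w)=d^n\big(f\circ(\varphi^{-1}\times\operatorname{id}_U)\big)\big((\varphi(x),0,\dots,0),w\big)$ for each chart $\varphi$ of $M$ around $x$. If, moreover, $E$ and $F$ are complex and $f(m,\cdot)\colon U\to F$ is holomorphic for all $m\in M$, then $f_\sharp$ is holomorphic. **Corollary.** If $M$ is a compact smooth manifold with corners, $U\subseteq E$ is open and $g\colon U\to F$ is smooth (respectively holomorphic), then $g\circ\gamma\in C^\infty(M,F)$ for each $\gamma\in C^\infty(M,U)$, and the push-forward $g_*\colon C^\infty(M,U)\to C^\infty(M,F)$, $\gamma\mapsto g\circ\gamma$, is smooth (respectively holomorphic). -/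

import Mathlib

open Set Filter Topology

noncomputable section

/-! ### Iterated tangent spaces of a vector space -/

/-- `T^n E = E^(2^n)`, as iterated pairs: `T^(n+1) E = T^n E × T^n E`. -/
def IterTan.{u} : ℕ → Type u → Type u
  | 0, E => E
  | n + 1, E => IterTan n E × IterTan n E

namespace IterTan

instance instAddCommGroup (E : Type*) [AddCommGroup E] : (n : ℕ) → AddCommGroup (IterTan n E)
  | 0 => inferInstanceAs (AddCommGroup E)
  | n + 1 =>
    letI := instAddCommGroup E n
    inferInstanceAs (AddCommGroup (IterTan n E × IterTan n E))

instance instModule (E : Type*) [AddCommGroup E] [Module ℝ E] : (n : ℕ) → Module ℝ (IterTan n E)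
  | 0 => inferInstanceAs (Module ℝ E)
  | n + 1 =>
    letI := instModule E n
    inferInstanceAs (Module ℝ (IterTan n E × IterTan n E))

instance instTopologicalSpace (E : Type*) [TopologicalSpace E] :
    (n : ℕ) → TopologicalSpace (IterTan n E)
  | 0 => inferInstanceAs (TopologicalSpace E)
  | n + 1 =>
    letI := instTopologicalSpace E n
    inferInstanceAs (TopologicalSpace (IterTan n E × IterTan n E))

/-- The subset `U × E^(2^n-1)` of `T^n E`: the base point lies in `U`, all other components are
arbitrary. -/
def tanOver {E : Type*} (U : Set E) : (n : ℕ) → Set (IterTan n E)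
  | 0 => U
  | n + 1 => (tanOver U n ×ˢ univ : Set (IterTan n E × IterTan n E))

/-- Apply a map to each of the `2^n` components. -/
def map {E F : Type*} (φ : E → F) : (n : ℕ) → IterTan n E → IterTan n F
  | 0, w => φ w
  | n + 1, w => (map φ n w.1, map φ n w.2)

/-- The element `(x, 0, …, 0)` of `T^n E`. -/
def zeroAt {E : Type*} [AddCommGroup E] (x : E) : (n : ℕ) → IterTan n E
  | 0 => x
  | n + 1 => (zeroAt x n, (0 : IterTan n E))

/-- The identification `T^n X × T^n E = T^n (X × E)`, componentwise. -/
def zip {X E : Type*} : (n : ℕ) → IterTan n X → IterTan n E → IterTan n (X × E)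
  | 0, a, b => ((a, b) : X × E)
  | n + 1, a, b => (zip n a.1 b.1, zip n a.2 b.2)

end IterTan

/-! ### Differential calculus on subsets with dense interior -/

section Calculus

variable {E F : Type*} [AddCommGroup E] [Module ℝ E] [TopologicalSpace E]
  [AddCommGroup F] [Module ℝ F] [TopologicalSpace F]

/-- `f` is `C¹` on `U` with differential `f'`: `f` is continuous on `U`, at every interior point `x`
and for every `v` the directional derivative exists and equals `f' (x, v)`, and `f'` is continuous
on `U × E`. Only the values of `f` on `U` and of `f'` on `U × E` matter. -/
structure HasDiffOn (f : E → F) (f' : E × E → F) (U : Set E) : Prop where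
  continuousOn : ContinuousOn f U
  tendsto : ∀ x ∈ interior U, ∀ v : E,
    Tendsto (fun h : ℝ => h⁻¹ • (f (x + h • v) - f x)) (𝓝[≠] 0) (𝓝 (f' (x, v)))
  continuousOn_diff : ContinuousOn f' (U ×ˢ univ)

/-- `g` is a sequence of higher differentials of `f` on `U`: `g 0 = f`, and `g (n+1)` is the
differential of `g n` on `U × E^(2^n-1)`. -/
structure IsDiffTower (f : E → F) (U : Set E) (g : (n : ℕ) → IterTan n E → F) : Prop where
  zero : g 0 = f
  succ : ∀ n, HasDiffOn (g n) (g (n + 1)) (IterTan.tanOver U n)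

/-- `f` is smooth on `U`: all higher differentials exist in the interior and extend continuously to
`U × E^(2^n-1)`. -/
def SmoothOn (f : E → F) (U : Set E) : Prop :=
  ∃ g : (n : ℕ) → IterTan n E → F, IsDiffTower f U g

open Classical in
/-- The `n`-th differential `dⁿf : U × E^(2^n-1) → F` of a smooth map `f` on `U`. If `U` has dense
interior and `F` is Hausdorff, it is uniquely determined on `U × E^(2^n-1)`. -/
def iterDiff (f : E → F) (U : Set E) (n : ℕ) : IterTan n E → F :=
  if h : SmoothOn f U then h.choose n else 0

/-- `f` is holomorphic on `U`: it is smooth and its differential is complex linear at each interior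
point. -/
def HolomorphicOn [Module ℂ E] [Module ℂ F] (f : E → F) (U : Set E) : Prop :=
  SmoothOn f U ∧ ∃ f' : E × E → F, HasDiffOn f f' U ∧
    ∀ x ∈ interior U, IsLinearMap ℂ (fun v => f' (x, v))

theorem SmoothOn.isDiffTower {f : E → F} {U : Set E} (h : SmoothOn f U) :
    IsDiffTower f U (iterDiff f U) := by
  have : iterDiff f U = h.choose := by
    funext n
    simp [iterDiff, h]
  rw [this]
  exact h.choose_spec

theorem SmoothOn.continuousOn_iterDiff {f : E → F} {U : Set E} (h : SmoothOn f U) (n : ℕ) :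
    ContinuousOn (iterDiff f U n) (IterTan.tanOver U n) :=
  (h.isDiffTower.succ n).continuousOn

theorem HasDiffOn.add [IsTopologicalAddGroup F] {f₁ f₂ : E → F} {g₁ g₂ : E × E → F} {U : Set E}
    (h₁ : HasDiffOn f₁ g₁ U) (h₂ : HasDiffOn f₂ g₂ U) : HasDiffOn (f₁ + f₂) (g₁ + g₂) U where
  continuousOn := h₁.continuousOn.add h₂.continuousOn
  tendsto x hx v := by
    refine ((h₁.tendsto x hx v).add (h₂.tendsto x hx v)).congr fun h => ?_
    simp only [Pi.add_apply, ← smul_add]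
    congr 1
    abel
  continuousOn_diff := h₁.continuousOn_diff.add h₂.continuousOn_diff

theorem HasDiffOn.const_smul {𝕜 : Type*} [Semiring 𝕜] [Module 𝕜 F] [SMulCommClass ℝ 𝕜 F]
    [ContinuousConstSMul 𝕜 F] (c : 𝕜) {f : E → F} {g : E × E → F} {U : Set E}
    (h : HasDiffOn f g U) : HasDiffOn (c • f) (c • g) U where
  continuousOn := h.continuousOn.const_smul c
  tendsto x hx v := by
    refine ((h.tendsto x hx v).const_smul c).congr fun t => ?_
    simp only [Pi.smul_apply]
    rw [← smul_comm, smul_sub]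
  continuousOn_diff := h.continuousOn_diff.const_smul c

theorem HasDiffOn.zero (U : Set E) : HasDiffOn (0 : E → F) (0 : E × E → F) U where
  continuousOn := continuousOn_const
  tendsto x hx v := by simpa using tendsto_const_nhds
  continuousOn_diff := continuousOn_const

theorem SmoothOn.zero (U : Set E) : SmoothOn (0 : E → F) U :=
  ⟨fun _ => 0, rfl, fun _ => HasDiffOn.zero _⟩

theorem SmoothOn.add [IsTopologicalAddGroup F] {f₁ f₂ : E → F} {U : Set E}
    (h₁ : SmoothOn f₁ U) (h₂ : SmoothOn f₂ U) : SmoothOn (f₁ + f₂) U := by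
  obtain ⟨g₁, h₁⟩ := h₁
  obtain ⟨g₂, h₂⟩ := h₂
  exact ⟨fun n => g₁ n + g₂ n, by rw [h₁.zero, h₂.zero]; rfl, fun n => (h₁.succ n).add (h₂.succ n)⟩

theorem SmoothOn.const_smul {𝕜 : Type*} [Semiring 𝕜] [Module 𝕜 F] [SMulCommClass ℝ 𝕜 F]
    [ContinuousConstSMul 𝕜 F] (c : 𝕜) {f : E → F} {U : Set E} (h : SmoothOn f U) :
    SmoothOn (c • f) U := by
  obtain ⟨g, h⟩ := h
  exact ⟨fun n => c • g n, by rw [h.zero]; rfl, fun n => (h.succ n).const_smul c⟩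

end Calculus

/-! ### Manifolds with corners -/

section Manifold

variable {X M E F : Type*} [AddCommGroup X] [Module ℝ X] [TopologicalSpace X] [TopologicalSpace M]
  [AddCommGroup E] [Module ℝ E] [TopologicalSpace E]
  [AddCommGroup F] [Module ℝ F] [TopologicalSpace F]

/-- A homeomorphism from an open subset `source` of `M` onto a relatively open subset `target` of
`P ⊆ X`. (The values of the two maps outside `source` and `target` are irrelevant.) -/
structure CornerChart (M : Type*) [TopologicalSpace M] {X : Type*} [TopologicalSpace X]
    (P : Set X) extends PartialEquiv M X where
  isOpen_source : IsOpen source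
  target_eq : ∃ O : Set X, IsOpen O ∧ target = O ∩ P
  continuousOn_toFun : ContinuousOn toFun source
  continuousOn_invFun : ContinuousOn invFun target

/-- The set `X⁺` of the points where the functionals `l 1, …, l k` are nonnegative. -/
def cornerSet {k : ℕ} (l : Fin k → X →L[ℝ] ℝ) : Set X := {x | ∀ i, 0 ≤ l i x}

/-- A differential structure with corners on `M`, modelled on `X⁺ ⊆ X`. It is not required to be
maximal; maximal ones (atlases) are a special case. -/
structure CornerStructure (X M : Type*) [AddCommGroup X] [Module ℝ X] [TopologicalSpace X]
    [TopologicalSpace M] where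
  /-- the number of functionals -/
  codim : ℕ
  /-- the functionals that cut out the model set -/
  functional : Fin codim → X →L[ℝ] ℝ
  dense_interior : cornerSet functional ⊆ closure (interior (cornerSet functional))
  /-- the charts -/
  charts : Set (CornerChart M (cornerSet functional))
  cover : ∀ m : M, ∃ e ∈ charts, m ∈ e.source
  compatible : ∀ e ∈ charts, ∀ e' ∈ charts,
    SmoothOn (fun x => e'.toFun (e.invFun x)) (e.target ∩ e.invFun ⁻¹' e'.source)

/-- `γ : M → F` is smooth: its coordinate representations are. -/
def IsSmooth (S : CornerStructure X M) (γ : M → F) : Prop :=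
  ∀ e ∈ S.charts, SmoothOn (fun x => γ (e.invFun x)) e.target

/-- The coordinate representation `(x, y) ↦ f (e⁻¹ x, y)` of a map `f` on `M × U`, with respect to
the product chart `e × id`. -/
def chartRep {P : Set X} (e : CornerChart M P) (f : M × E → F) : X × E → F :=
  fun p => f (e.invFun p.1, p.2)

/-- `f : M × U → F` is smooth on the product manifold `M × U`. -/
def IsSmoothProd (S : CornerStructure X M) (f : M × E → F) (U : Set E) : Prop :=
  ∀ e ∈ S.charts, SmoothOn (chartRep e f) (e.target ×ˢ U)

/-- `d₂ⁿf (x, w) = dⁿf ((x, 0, …, 0), w)` for `w ∈ U × E^(2^n-1)`, computed in the chart `e`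
around `x`: the `n`-th differential of `f` with all directions in `M` equal to zero. -/
def iterDiffSnd {P : Set X} (e : CornerChart M P) (f : M × E → F) (U : Set E) (n : ℕ)
    (x : M) (w : IterTan n E) : F :=
  iterDiff (chartRep e f) (e.target ×ˢ U) n (IterTan.zip n (IterTan.zeroAt (e.toFun x) n) w)

end Manifold

/-! ### The locally convex space `C^∞(M, F)` -/

section SmoothMap

variable {X M : Type*} [AddCommGroup X] [Module ℝ X] [TopologicalSpace X] [TopologicalSpace M]

/-- Smooth maps form a linear subspace of the space of all maps `M → F`. -/
def smoothSubmodule (S : CornerStructure X M) (F : Type*) [AddCommGroup F] [Module ℝ F]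
    [TopologicalSpace F] [IsTopologicalAddGroup F] [ContinuousSMul ℝ F] :
    Submodule ℝ (M → F) where
  carrier := {γ | IsSmooth S γ}
  add_mem' h₁ h₂ := fun e he => (h₁ e he).add (h₂ e he)
  zero_mem' := fun _ _ => SmoothOn.zero _
  smul_mem' c _ h := fun e he => (h e he).const_smul c

/-- The space `C^∞(M, F)`. -/
def SmoothMap (S : CornerStructure X M) (F : Type*) [AddCommGroup F] [Module ℝ F]
    [TopologicalSpace F] [IsTopologicalAddGroup F] [ContinuousSMul ℝ F] : Type _ :=
  smoothSubmodule S F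

namespace SmoothMap

variable (S : CornerStructure X M)
  {E F : Type*} [AddCommGroup E] [Module ℝ E] [TopologicalSpace E] [IsTopologicalAddGroup E]
  [ContinuousSMul ℝ E]
  [AddCommGroup F] [Module ℝ F] [TopologicalSpace F] [IsTopologicalAddGroup F]
  [ContinuousSMul ℝ F]

instance : AddCommGroup (SmoothMap S F) := inferInstanceAs (AddCommGroup (smoothSubmodule S F))

instance : Module ℝ (SmoothMap S F) := inferInstanceAs (Module ℝ (smoothSubmodule S F))

instance : CoeFun (SmoothMap S F) (fun _ => M → F) := ⟨Subtype.val⟩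

/-- Pointwise multiplication with complex scalars. -/
instance [Module ℂ F] [IsScalarTower ℝ ℂ F] [ContinuousSMul ℂ F] : SMul ℂ (SmoothMap S F) :=
  ⟨fun c γ => ⟨c • γ.1, fun e he => (γ.2 e he).const_smul c⟩⟩

/-- If `F` is complex, so is `C^∞(M, F)`. -/
instance [Module ℂ F] [IsScalarTower ℝ ℂ F] [ContinuousSMul ℂ F] : Module ℂ (SmoothMap S F) :=
  Function.Injective.module ℂ (smoothSubmodule S F).subtype.toAddMonoidHom
    Subtype.val_injective fun _ _ => rfl

variable {S}

/-- The `n`-th differential of `γ` in a chart `e`, i.e. `dⁿγ` on the chart domain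
`T^n (e.source) ≅ e.target × X^(2^n-1)` of `T^n M`. -/
def chartDiff (e : S.charts) (n : ℕ) (γ : SmoothMap S F) : C(IterTan.tanOver e.1.target n, F) where
  toFun w := iterDiff (fun x => γ (e.1.invFun x)) e.1.target n w
  continuous_toFun := continuousOn_iff_continuous_domRestrict.1
    ((γ.2 e.1 e.2).continuousOn_iterDiff n)

variable (S)

/-- The topology of `C^∞(M, F)`: the initial topology for the maps `γ ↦ dⁿγ` (in all charts, for
all `n`) into spaces of continuous maps with the topology of compact convergence. -/
instance : TopologicalSpace (SmoothMap S F) :=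
  ⨅ (e : S.charts) (n : ℕ),
    TopologicalSpace.induced (chartDiff e n) ContinuousMap.compactOpen

/-- The subset `C^∞(M, U)` of `C^∞(M, E)`. -/
def into (U : Set E) : Set (SmoothMap S E) := {γ | ∀ x : M, γ x ∈ U}

open Classical in
/-- A map `M → F`, if smooth, as an element of `C^∞(M, F)` (and the junk value `0` otherwise). -/
def ofFun (h : M → F) : SmoothMap S F := if hs : IsSmooth S h then ⟨h, hs⟩ else 0

/-- `f_♯ : γ ↦ f ∘ (id, γ)`. -/
def sharp (f : M × E → F) (γ : SmoothMap S E) : SmoothMap S F := ofFun S fun x => f (x, γ x)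

/-- `g_* : γ ↦ g ∘ γ`. -/
def pushforward (g : E → F) (γ : SmoothMap S E) : SmoothMap S F := ofFun S fun x => g (γ x)

end SmoothMap

end SmoothMap

end

/-!
The difference quotients of `f` in its second variable converge to `d₂f`, jointly in all variables
and up to the boundary of a chart: the mean value theorem (by separation of closed convex sets)
encloses them over interior points, and the closed enclosure passes to boundary points by density.
Joint convergence implies compact convergence of the difference quotients along a map `γ`.

In a chart, Faà di Bruno's formula takes the form
`dⁿ(f ∘ (id, γ))(w) = dⁿf (w, Tⁿγ(w))`, where `Tⁿγ : TⁿX → TⁿE` is the iterated tangent map. That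
`Tⁿγ` is again smooth, with the expected differentials, rests on the symmetry of second
differentials. Applying the first step to `dⁿf`, for all `n`, shows that `f_♯` is `C¹` with
`d(f_♯)(γ, η) = (d₂f)_♯(γ, η)` under the identification `C^∞(M, E)² = C^∞(M, E²)`. Since `d₂f` is
again a smooth map on `M × (U × E)`, this can be iterated, and `dⁿ(f_♯) = (d₂ⁿf)_♯` under
`Tⁿ C^∞(M, E) = C^∞(M, TⁿE)`. Complex linearity of `d(f_♯)(γ)` is checked pointwise.
-/

namespace IterTan

section Instances

variable (E : Type*) [TopologicalSpace E]

instance instIsTopologicalAddGroup [AddCommGroup E] [IsTopologicalAddGroup E] :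
    (n : ℕ) → IsTopologicalAddGroup (IterTan n E)
  | 0 => inferInstanceAs (IsTopologicalAddGroup E)
  | n + 1 =>
    letI := instIsTopologicalAddGroup n
    inferInstanceAs (IsTopologicalAddGroup (IterTan n E × IterTan n E))

instance instContinuousSMul [AddCommGroup E] [Module ℝ E] [ContinuousSMul ℝ E] :
    (n : ℕ) → ContinuousSMul ℝ (IterTan n E)
  | 0 => inferInstanceAs (ContinuousSMul ℝ E)
  | n + 1 =>
    letI := instContinuousSMul n
    inferInstanceAs (ContinuousSMul ℝ (IterTan n E × IterTan n E))

instance instLocallyConvexSpace [AddCommGroup E] [Module ℝ E] [LocallyConvexSpace ℝ E] :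
    (n : ℕ) → LocallyConvexSpace ℝ (IterTan n E)
  | 0 => inferInstanceAs (LocallyConvexSpace ℝ E)
  | n + 1 =>
    letI := instLocallyConvexSpace n
    inferInstanceAs (LocallyConvexSpace ℝ (IterTan n E × IterTan n E))

instance instT2Space [T2Space E] : (n : ℕ) → T2Space (IterTan n E)
  | 0 => inferInstanceAs (T2Space E)
  | n + 1 =>
    letI := instT2Space n
    inferInstanceAs (T2Space (IterTan n E × IterTan n E))

end Instances

end IterTan

/-! ### The mean value theorem in locally convex spaces -/

section MeanValue

theorem eventually_ne_and_forall_mem_uIcc {a : ℝ} {p : ℝ → Prop} (h : ∀ᶠ t in 𝓝 a, p t) :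
    ∀ᶠ b in 𝓝[≠] a, b ≠ a ∧ ∀ t ∈ uIcc a b, p t :=
  eventually_mem_nhdsWithin.and
    (nhdsWithin_le_nhds ((tendsto_const_nhds.uIcc tendsto_id).eventually h.smallSets))

theorem exists_mem_uIcc_hasDerivAt_eq_slope {f f' : ℝ → ℝ} {a b : ℝ} (hab : a ≠ b)
    (hf : ∀ t ∈ uIcc a b, HasDerivAt f (f' t) t) : ∃ ξ ∈ uIcc a b, f' ξ = slope f a b := by
  wlog h : a < b generalizing a b
  · rw [uIcc_comm, slope_comm]
    exact this hab.symm (by rwa [uIcc_comm]) (lt_of_le_of_ne (not_lt.1 h) hab.symm)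
  rw [uIcc_of_lt h] at hf ⊢
  obtain ⟨ξ, hξ, hslope⟩ := exists_hasDerivAt_eq_slope f f' h
    (fun t ht => (hf t ht).continuousAt.continuousWithinAt)
    (fun t ht => hf t (Ioo_subset_Icc_self ht))
  exact ⟨ξ, Ioo_subset_Icc_self hξ, by rw [hslope, slope_def_field]⟩

variable {F : Type*} [AddCommGroup F] [Module ℝ F] [TopologicalSpace F] [IsTopologicalAddGroup F]
  [ContinuousSMul ℝ F] [LocallyConvexSpace ℝ F]

theorem exists_convex_closed_nhds_subset {x : F} {W : Set F} (hW : W ∈ 𝓝 x) :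
    ∃ K ∈ 𝓝 x, Convex ℝ K ∧ IsClosed K ∧ K ⊆ W := by
  obtain ⟨C, hC, hCclosed, hCW⟩ := exists_mem_nhds_isClosed_subset hW
  obtain ⟨V, ⟨hV, hVconvex⟩, hVC⟩ := (LocallyConvexSpace.convex_basis (𝕜 := ℝ) x).mem_iff.1 hC
  exact ⟨closure V, mem_of_superset hV subset_closure, hVconvex.closure, isClosed_closure,
    (closure_minimal hVC hCclosed).trans hCW⟩

theorem slope_mem_of_deriv_mem {c c' : ℝ → F} {K : Set F} (hK : Convex ℝ K) (hKc : IsClosed K)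
    {h : ℝ} (hh : h ≠ 0)
    (hc : ∀ t ∈ uIcc 0 h, Tendsto (fun s : ℝ => s⁻¹ • (c (t + s) - c t)) (𝓝[≠] 0) (𝓝 (c' t)))
    (hm : ∀ t ∈ uIcc 0 h, c' t ∈ K) : h⁻¹ • (c h - c 0) ∈ K := by
  by_contra hn
  obtain ⟨l, u, hlK, hlu⟩ := geometric_hahn_banach_closed_point hK hKc hn
  have hderiv : ∀ t ∈ uIcc 0 h, HasDerivAt (fun t => l (c t)) (l (c' t)) t := by
    intro t ht
    rw [hasDerivAt_iff_tendsto_slope_zero]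
    simpa only [Function.comp_def, map_smul, map_sub] using (l.continuous.tendsto _).comp (hc t ht)
  obtain ⟨ξ, hξ, hslope⟩ := exists_mem_uIcc_hasDerivAt_eq_slope hh.symm hderiv
  have hslope : l (c' ξ) = l (h⁻¹ • (c h - c 0)) := by
    simpa only [slope_def_module, sub_zero, map_smul, map_sub] using hslope
  exact lt_asymm (hlK _ (hm ξ hξ)) (hslope ▸ hlu)

theorem tendsto_second_difference {φ φ₁ φ₁₂ : ℝ → ℝ → F} {a : F}
    (h₁ : ∀ᶠ p : ℝ × ℝ in 𝓝 0, Tendsto (fun s : ℝ => s⁻¹ • (φ (p.1 + s) p.2 - φ p.1 p.2))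
      (𝓝[≠] 0) (𝓝 (φ₁ p.1 p.2)))
    (h₁₂ : ∀ᶠ p : ℝ × ℝ in 𝓝 0, Tendsto (fun s : ℝ => s⁻¹ • (φ₁ p.1 (p.2 + s) - φ₁ p.1 p.2))
      (𝓝[≠] 0) (𝓝 (φ₁₂ p.1 p.2)))
    (hlim : Tendsto (fun p : ℝ × ℝ => φ₁₂ p.1 p.2) (𝓝 0) (𝓝 a)) :
    Tendsto (fun h : ℝ => h⁻¹ • h⁻¹ • (φ h h - φ h 0 - (φ 0 h - φ 0 0))) (𝓝[≠] 0) (𝓝 a) := by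
  intro W hW
  obtain ⟨K, hK, hKconvex, hKclosed, hKW⟩ := exists_convex_closed_nhds_subset hW
  obtain ⟨p, hp, q, hq, H⟩ := eventually_prod_iff.1
    (nhds_prod_eq (x := (0 : ℝ)) (y := (0 : ℝ)) ▸ h₁.and (h₁₂.and (hlim.eventually_mem hK)))
  rw [mem_map]
  filter_upwards [eventually_ne_and_forall_mem_uIcc hp,
    eventually_ne_and_forall_mem_uIcc hq] with h ⟨hh, hph⟩ ⟨_, hqh⟩
  have hslope₁ : ∀ t ∈ uIcc 0 h, h⁻¹ • (φ₁ t h - φ₁ t 0) ∈ K := fun t ht =>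
    slope_mem_of_deriv_mem hKconvex hKclosed hh (fun r hr => (H (hph t ht) (hqh r hr)).2.1)
      fun r hr => (H (hph t ht) (hqh r hr)).2.2
  have hslope : h⁻¹ • (h⁻¹ • (φ h h - φ h 0) - h⁻¹ • (φ 0 h - φ 0 0)) ∈ K := by
    refine slope_mem_of_deriv_mem (c := fun s => h⁻¹ • (φ s h - φ s 0)) hKconvex hKclosed hh
      (fun t ht => ?_) hslope₁
    refine (((H (hph t ht) (hqh h right_mem_uIcc)).1.sub
      (H (hph t ht) (hqh 0 left_mem_uIcc)).1).const_smul h⁻¹).congr fun s => ?_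
    module
  exact hKW (by simpa only [← smul_sub] using hslope)

end MeanValue

/-! ### Differentials on sets with dense interior -/

section Differential

variable {E F G : Type*} [AddCommGroup E] [Module ℝ E] [TopologicalSpace E]
  [AddCommGroup F] [Module ℝ F] [TopologicalSpace F]
  [AddCommGroup G] [Module ℝ G] [TopologicalSpace G]

theorem HasDiffOn.prodMk {f : E → F} {g : E → G} {f' : E × E → F} {g' : E × E → G} {U : Set E}
    (hf : HasDiffOn f f' U) (hg : HasDiffOn g g' U) :
    HasDiffOn (fun x => (f x, g x)) (fun p => (f' p, g' p)) U where
  continuousOn := hf.continuousOn.prodMk hg.continuousOn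
  tendsto x hx v := (hf.tendsto x hx v).prodMk_nhds (hg.tendsto x hx v)
  continuousOn_diff := hf.continuousOn_diff.prodMk hg.continuousOn_diff

theorem HasDiffOn.comp_linear {f : F → G} {f' : F × F → G} {V : Set F} (hf : HasDiffOn f f' V)
    {L : E → F} (hL : Continuous L) (hlin : ∀ x v (t : ℝ), L (x + t • v) = L x + t • L v)
    {A : Set E} (hA : MapsTo L A V) (hAi : MapsTo L (interior A) (interior V)) :
    HasDiffOn (fun x => f (L x)) (fun p => f' (L p.1, L p.2)) A where
  continuousOn := hf.continuousOn.comp hL.continuousOn hA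
  tendsto x hx v := by
    refine (hf.tendsto (L x) (hAi hx) (L v)).congr fun h => ?_
    rw [hlin]
  continuousOn_diff := hf.continuousOn_diff.comp (by fun_prop) fun p hp => ⟨hA hp.1, mem_univ _⟩

theorem HasDiffOn.clm_comp (L : F →L[ℝ] G) {f : E → F} {f' : E × E → F} {U : Set E}
    (hf : HasDiffOn f f' U) : HasDiffOn (fun x => L (f x)) (fun p => L (f' p)) U where
  continuousOn := L.continuous.comp_continuousOn hf.continuousOn
  tendsto x hx v := by
    simpa only [Function.comp_def, map_smul, map_sub] using
      (L.continuous.tendsto _).comp (hf.tendsto x hx v)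
  continuousOn_diff := L.continuous.comp_continuousOn hf.continuousOn_diff

theorem HasDiffOn.id (U : Set E) : HasDiffOn (fun x => x) Prod.snd U where
  continuousOn := continuousOn_id
  tendsto x _ v := by
    refine tendsto_const_nhds.congr' ?_
    filter_upwards [self_mem_nhdsWithin] with h hh
    rw [add_sub_cancel_left, inv_smul_smul₀ hh]
  continuousOn_diff := continuousOn_snd

theorem HasDiffOn.slope_mem_of_mem_interior [IsTopologicalAddGroup F] [ContinuousSMul ℝ F]
    [LocallyConvexSpace ℝ F] {f : E → F} {f' : E × E → F} {A : Set E}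
    (hf : HasDiffOn f f' A) {K : Set F} (hK : Convex ℝ K) (hKc : IsClosed K) {h : ℝ} (hh : h ≠ 0)
    {y v : E} (hy : ∀ t ∈ uIcc 0 h, y + t • v ∈ interior A)
    (hm : ∀ t ∈ uIcc 0 h, f' (y + t • v, v) ∈ K) : h⁻¹ • (f (y + h • v) - f y) ∈ K := by
  have hslope := slope_mem_of_deriv_mem (c := fun t => f (y + t • v)) hK hKc hh (fun t ht => ?_) hm
  · simpa only [zero_smul, add_zero] using hslope
  · refine (hf.tendsto _ (hy t ht) v).congr fun s => ?_
    rw [add_smul, add_assoc]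

section Uniqueness

variable [IsTopologicalAddGroup E] [ContinuousSMul ℝ E]

theorem slope_eventuallyEq_of_eqOn {Y : Type*} [AddCommGroup Y] [Module ℝ Y] {f g : E → Y}
    {U : Set E} (h : EqOn f g U) {x : E} (hx : x ∈ interior U) (v : E) :
    (fun t : ℝ => t⁻¹ • (f (x + t • v) - f x)) =ᶠ[𝓝[≠] 0]
      fun t => t⁻¹ • (g (x + t • v) - g x) := by
  have hcont : ContinuousAt (fun t : ℝ => x + t • v) 0 := by fun_prop
  have hmem : ∀ᶠ t : ℝ in 𝓝 0, x + t • v ∈ U :=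
    hcont.eventually_mem (by simpa using mem_interior_iff_mem_nhds.1 hx)
  filter_upwards [nhdsWithin_le_nhds hmem] with t ht
  rw [h ht, h (interior_subset hx)]

theorem HasDiffOn.congr {f g : E → F} {f' g' : E × E → F} {U : Set E} (hf : HasDiffOn f f' U)
    (h : EqOn g f U) (h' : EqOn g' f' (U ×ˢ univ)) : HasDiffOn g g' U where
  continuousOn := hf.continuousOn.congr h
  tendsto x hx v := by
    rw [h' ⟨interior_subset hx, mem_univ _⟩]
    exact (hf.tendsto x hx v).congr' (slope_eventuallyEq_of_eqOn h hx v).symm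
  continuousOn_diff := hf.continuousOn_diff.congr h'

theorem HasDiffOn.eqOn_diff [T2Space F] {f g : E → F} {f' g' : E × E → F} {U : Set E}
    (hU : U ⊆ closure (interior U)) (hf : HasDiffOn f f' U) (hg : HasDiffOn g g' U)
    (h : EqOn f g U) : EqOn f' g' (U ×ˢ univ) := by
  refine EqOn.of_subset_closure (s := interior U ×ˢ univ) ?_ hf.continuousOn_diff
    hg.continuousOn_diff (prod_mono_left interior_subset) ?_
  · rintro ⟨x, v⟩ ⟨hx, -⟩
    exact tendsto_nhds_unique_of_eventuallyEq (hf.tendsto x hx v) (hg.tendsto x hx v)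
      (slope_eventuallyEq_of_eqOn h hx v)
  · rw [closure_prod_eq, closure_univ]
    exact prod_mono_left hU

end Uniqueness

section Chain

variable [IsTopologicalAddGroup E] [ContinuousSMul ℝ E]
  [IsTopologicalAddGroup F] [ContinuousSMul ℝ F] [LocallyConvexSpace ℝ F]

theorem HasDiffOn.tendsto_slope_of_mem_interior {f : E → F} {f' : E × E → F} {A : Set E}
    (hf : HasDiffOn f f' A) {x : E} (hx : x ∈ interior A) (v : E) :
    Tendsto (fun p : ℝ × E => p.1⁻¹ • (f (x + p.1 • p.2) - f x))
      (𝓝[≠] 0 ×ˢ 𝓝 v) (𝓝 (f' (x, v))) := by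
  intro W hW
  obtain ⟨K, hK, hKconvex, hKclosed, hKW⟩ := exists_convex_closed_nhds_subset hW
  have hline : ContinuousAt (fun p : ℝ × E => x + p.1 • p.2) (0, v) := by fun_prop
  have hline_mem : ∀ᶠ p : ℝ × E in 𝓝 (0, v), x + p.1 • p.2 ∈ interior A :=
    hline.eventually_mem (by simpa using isOpen_interior.mem_nhds hx)
  have hdiff_mem : ∀ᶠ p : ℝ × E in 𝓝 (0, v), f' (x + p.1 • p.2, p.2) ∈ K := by
    refine ContinuousAt.eventually_mem (f := fun p : ℝ × E => f' (x + p.1 • p.2, p.2))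
      (ContinuousAt.comp (g := f') ?_ (hline.prodMk continuousAt_snd)) (by simpa using hK)
    refine hf.continuousOn_diff.continuousAt (prod_mem_nhds ?_ univ_mem)
    simpa using mem_interior_iff_mem_nhds.1 hx
  obtain ⟨p, hp, q, hq, H⟩ := eventually_prod_iff.1
    (nhds_prod_eq (x := (0 : ℝ)) (y := v) ▸ hline_mem.and hdiff_mem)
  rw [mem_map]
  filter_upwards [(eventually_ne_and_forall_mem_uIcc hp).prod_mk hq]
  rintro ⟨h, u⟩ ⟨⟨hh, hph⟩, hu⟩
  exact hKW (hf.slope_mem_of_mem_interior hKconvex hKclosed hh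
    (fun t ht => (H (hph t ht) hu).1) fun t ht => (H (hph t ht) hu).2)

theorem HasDiffOn.comp {f : E → F} {f' : E × E → F} {V : Set E} {g : G → E} {g' : G × G → E}
    {A : Set G} (hf : HasDiffOn f f' V) (hg : HasDiffOn g g' A)
    (hm : MapsTo g A V) (hmi : MapsTo g (interior A) (interior V)) :
    HasDiffOn (fun x => f (g x)) (fun p => f' (g p.1, g' p)) A where
  continuousOn := hf.continuousOn.comp hg.continuousOn hm
  tendsto x hx v := by
    refine ((hf.tendsto_slope_of_mem_interior (hmi hx) (g' (x, v))).comp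
      (tendsto_id.prodMk (hg.tendsto x hx v))).congr' ?_
    filter_upwards [self_mem_nhdsWithin] with h hh
    simp only [Function.comp_apply, id_eq, smul_inv_smul₀ hh, add_sub_cancel]
  continuousOn_diff := by
    refine hf.continuousOn_diff.comp (ContinuousOn.prodMk ?_ hg.continuousOn_diff) ?_
    · exact hg.continuousOn.comp continuousOn_fst fun p hp => hp.1
    · exact fun p hp => ⟨hm hp.1, mem_univ _⟩

end Chain

section SlopeSnd

variable {X : Type*} [AddCommGroup X] [Module ℝ X] [TopologicalSpace X]
  [IsTopologicalAddGroup F] [ContinuousSMul ℝ F] [LocallyConvexSpace ℝ F]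

/-- The difference quotients of `f` are controlled by `f'` only over interior points of `T`; at a
boundary point the slope in the second variable is a limit of such slopes. -/
theorem HasDiffOn.slope_snd_mem {f : X × E → F} {f' : (X × E) × (X × E) → F} {T : Set X}
    {U : Set E} (hT : T ⊆ closure (interior T)) (hU : IsOpen U) (hf : HasDiffOn f f' (T ×ˢ U))
    {K : Set F} (hK : Convex ℝ K) (hKc : IsClosed K) {h : ℝ} (hh : h ≠ 0) {x : X} (hx : x ∈ T)
    {y v : E} (hy : ∀ t ∈ uIcc 0 h, y + t • v ∈ U)
    (hm : ∀ᶠ z in 𝓝[T] x, ∀ t ∈ uIcc 0 h, f' ((z, y + t • v), (0, v)) ∈ K) :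
    h⁻¹ • (f (x, y + h • v) - f (x, y)) ∈ K := by
  have hne : (𝓝[interior T] x).NeBot := mem_closure_iff_nhdsWithin_neBot.1 (hT hx)
  have hcont (t : ℝ) (ht : t ∈ uIcc 0 h) :
      Tendsto (fun z => f (z, y + t • v)) (𝓝[interior T] x) (𝓝 (f (x, y + t • v))) := by
    have : ContinuousOn (fun z => f (z, y + t • v)) T :=
      hf.continuousOn.comp (by fun_prop) fun z hz => ⟨hz, hy t ht⟩
    exact (this x hx).mono_left (nhdsWithin_mono x interior_subset)
  have hlim : Tendsto (fun z => h⁻¹ • (f (z, y + h • v) - f (z, y))) (𝓝[interior T] x)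
      (𝓝 (h⁻¹ • (f (x, y + h • v) - f (x, y)))) := by
    simpa only [zero_smul, add_zero] using
      ((hcont h right_mem_uIcc).sub (hcont 0 left_mem_uIcc)).const_smul h⁻¹
  refine hKc.mem_of_tendsto hlim ?_
  filter_upwards [self_mem_nhdsWithin, nhdsWithin_mono x interior_subset hm] with z hz hmz
  have hline (t : ℝ) : (z, y) + t • ((0, v) : X × E) = (z, y + t • v) := by simp
  have hslope := hf.slope_mem_of_mem_interior (y := (z, y)) (v := ((0 : X), v)) hK hKc hh
    (fun t ht => ?_) fun t ht => ?_
  · rwa [hline] at hslope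
  · rw [hline, interior_prod_eq, hU.interior_eq]
    exact ⟨hz, hy t ht⟩
  · rw [hline]
    exact hmz t ht

theorem HasDiffOn.tendsto_slope_snd [IsTopologicalAddGroup E] [ContinuousSMul ℝ E]
    {f : X × E → F} {f' : (X × E) × (X × E) → F} {T : Set X} {U : Set E}
    (hT : T ⊆ closure (interior T)) (hU : IsOpen U) (hf : HasDiffOn f f' (T ×ˢ U))
    {x : X} (hx : x ∈ T) {y : E} (hy : y ∈ U) (v : E) :
    Tendsto (fun p : ℝ × X × E × E =>
        p.1⁻¹ • (f (p.2.1, p.2.2.1 + p.1 • p.2.2.2) - f (p.2.1, p.2.2.1)))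
      (𝓝[≠] 0 ×ˢ (𝓝[T] x ×ˢ (𝓝 y ×ˢ 𝓝 v))) (𝓝 (f' ((x, y), (0, v)))) := by
  intro W hW
  obtain ⟨K, hK, hKconvex, hKclosed, hKW⟩ := exists_convex_closed_nhds_subset hW
  have hline : Tendsto (fun p : ℝ × X × E × E => p.2.2.1 + p.1 • p.2.2.2)
      (𝓝 0 ×ˢ (𝓝[T] x ×ˢ (𝓝 y ×ˢ 𝓝 v))) (𝓝 y) := by
    have hc : Continuous fun p : ℝ × X × E × E => p.2.2.1 + p.1 • p.2.2.2 := by fun_prop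
    have := hc.tendsto (0, x, y, v)
    simp only [zero_smul, add_zero, nhds_prod_eq] at this
    exact this.mono_left (prod_mono_right _ (prod_mono_left _ nhdsWithin_le_nhds))
  have hbase : ∀ᶠ p : ℝ × X × E × E in 𝓝 0 ×ˢ (𝓝[T] x ×ˢ (𝓝 y ×ˢ 𝓝 v)), p.2.1 ∈ T :=
    (tendsto_fst.comp tendsto_snd).eventually self_mem_nhdsWithin
  have hline_mem := hline.eventually_mem (hU.mem_nhds hy)
  have hdiff : Tendsto
      (fun p : ℝ × X × E × E => f' ((p.2.1, p.2.2.1 + p.1 • p.2.2.2), (0, p.2.2.2)))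
      (𝓝 0 ×ˢ (𝓝[T] x ×ˢ (𝓝 y ×ˢ 𝓝 v))) (𝓝 (f' ((x, y), (0, v)))) := by
    refine (hf.continuousOn_diff _ ⟨⟨hx, hy⟩, mem_univ _⟩).tendsto.comp
      (tendsto_nhdsWithin_iff.2 ⟨?_, hbase.mp (hline_mem.mono fun p hU hT => ⟨⟨hT, hU⟩, trivial⟩)⟩)
    have hx : Tendsto (fun p : ℝ × X × E × E => p.2.1)
        (𝓝 0 ×ˢ (𝓝[T] x ×ˢ (𝓝 y ×ˢ 𝓝 v))) (𝓝 x) :=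
      (tendsto_fst.comp tendsto_snd).mono_right nhdsWithin_le_nhds
    exact (hx.prodMk_nhds hline).prodMk_nhds (tendsto_const_nhds.prodMk_nhds
      (tendsto_snd.comp (tendsto_snd.comp tendsto_snd)))
  obtain ⟨p, hp, q, hq, H⟩ := eventually_prod_iff.1 (hline_mem.and (hdiff.eventually_mem hK))
  obtain ⟨r, hr, s, hs, H'⟩ := eventually_prod_iff.1 hq
  rw [mem_map]
  filter_upwards [(eventually_ne_and_forall_mem_uIcc hp).prod_mk
    (((eventually_eventually_nhdsWithin.2 hr).and
      (hr.and eventually_mem_nhdsWithin)).prod_mk hs)]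
  rintro ⟨h, z, w⟩ ⟨⟨hh, hph⟩, ⟨hrz', hrz, hz⟩, hsw⟩
  exact hKW (hf.slope_snd_mem hT hU hKconvex hKclosed hh hz
    (fun t ht => (H (hph t ht) (H' hrz hsw)).1)
    (hrz'.mono fun z' hz' t ht => (H (hph t ht) (H' hz' hsw)).2))

end SlopeSnd

section Symmetry

variable [IsTopologicalAddGroup E] [ContinuousSMul ℝ E]
  [IsTopologicalAddGroup F] [ContinuousSMul ℝ F] [LocallyConvexSpace ℝ F]

/-- For fixed `t` the line `s ↦ a + s b + t c + s t d` has velocity `b + t d`, so that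
differentiating in `s` and then in `t` gives `g'' ((a, b), (c, d))`. Swapping `b` and `c` does not
change the left-hand side: this is the symmetry of second differentials. -/
theorem HasDiffOn.tendsto_second_difference {g : E → F} {g' : E × E → F}
    {g'' : (E × E) × (E × E) → F} {A : Set E} (h₁ : HasDiffOn g g' A)
    (h₂ : HasDiffOn g' g'' (A ×ˢ univ)) {a : E} (ha : a ∈ interior A) (b c d : E) :
    Tendsto (fun h : ℝ => h⁻¹ • h⁻¹ • (g (a + h • b + h • c + (h * h) • d) - g (a + h • b) -
      (g (a + h • c) - g a))) (𝓝[≠] 0) (𝓝 (g'' ((a, b), (c, d)))) := by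
  have hpoint : Continuous fun p : ℝ × ℝ => a + p.1 • b + p.2 • c + (p.1 * p.2) • d := by fun_prop
  have hmem : ∀ᶠ p : ℝ × ℝ in 𝓝 0, a + p.1 • b + p.2 • c + (p.1 * p.2) • d ∈ interior A :=
    hpoint.continuousAt.eventually_mem (by simpa using isOpen_interior.mem_nhds ha)
  have hlim := _root_.tendsto_second_difference (a := g'' ((a, b), (c, d)))
    (φ := fun s t => g (a + s • b + t • c + (s * t) • d))
    (φ₁ := fun s t => g' (a + s • b + t • c + (s * t) • d, b + t • d))
    (φ₁₂ := fun s t => g'' ((a + s • b + t • c + (s * t) • d, b + t • d), (c + s • d, d))) ?_ ?_ ?_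
  · simpa using hlim
  · filter_upwards [hmem] with p hp
    refine (h₁.tendsto _ hp _).congr fun s => ?_
    congr 3
    module
  · filter_upwards [hmem] with p hp
    refine (h₂.tendsto (_, _) (by simpa [interior_prod_eq] using hp) (_, _)).congr fun s => ?_
    congr 3
    simp only [Prod.smul_mk, Prod.mk_add_mk, Prod.mk.injEq]
    constructor <;> module
  · have hcont : ContinuousAt g'' ((a, b), (c, d)) := h₂.continuousOn_diff.continuousAt
      (prod_mem_nhds (prod_mem_nhds (mem_interior_iff_mem_nhds.1 ha) univ_mem) univ_mem)
    have hpoint' : Continuous fun p : ℝ × ℝ =>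
        ((a + p.1 • b + p.2 • c + (p.1 * p.2) • d, b + p.2 • d), (c + p.1 • d, d)) := by fun_prop
    exact hcont.tendsto.comp (by simpa using hpoint'.tendsto 0)

theorem HasDiffOn.diff_diff_comm [T2Space F] {g : E → F} {g' : E × E → F}
    {g'' : (E × E) × (E × E) → F} {A : Set E} (hA : A ⊆ closure (interior A))
    (h₁ : HasDiffOn g g' A) (h₂ : HasDiffOn g' g'' (A ×ˢ univ)) {a : E} (ha : a ∈ A) (b c d : E) :
    g'' ((a, b), (c, d)) = g'' ((a, c), (b, d)) := by
  suffices H : EqOn (fun x => g'' ((x, b), (c, d))) (fun x => g'' ((x, c), (b, d))) A from H ha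
  refine EqOn.of_subset_closure (s := interior A) (fun x hx => ?_)
    (h₂.continuousOn_diff.comp (by fun_prop) fun x hx => ⟨⟨hx, mem_univ _⟩, mem_univ _⟩)
    (h₂.continuousOn_diff.comp (by fun_prop) fun x hx => ⟨⟨hx, mem_univ _⟩, mem_univ _⟩)
    interior_subset hA
  refine tendsto_nhds_unique (h₁.tendsto_second_difference h₂ hx b c d)
    ((h₁.tendsto_second_difference h₂ hx c b d).congr fun h => ?_)
  rw [add_right_comm x (h • c), sub_sub_sub_comm]

end Symmetry

end Differential

/-! ### Sequences of higher differentials -/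

theorem prod_subset_closure_interior_prod {X Y : Type*} [TopologicalSpace X] [TopologicalSpace Y]
    {A : Set X} {B : Set Y} (hA : A ⊆ closure (interior A)) (hB : IsOpen B) :
    A ×ˢ B ⊆ closure (interior (A ×ˢ B)) := by
  rw [interior_prod_eq, closure_prod_eq, hB.interior_eq]
  exact prod_mono hA subset_closure

namespace IterTan

variable {X E F : Type*}

theorem map_mem_tanOver {φ : E → F} {A : Set E} {B : Set F} (h : MapsTo φ A B) :
    (n : ℕ) → MapsTo (map φ n) (tanOver A n) (tanOver B n)
  | 0, _, hw => h hw
  | n + 1, _, hw => ⟨map_mem_tanOver h n hw.1, mem_univ _⟩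

theorem zip_mem_tanOver {A : Set E} {B : Set F} : (n : ℕ) → {a : IterTan n E} →
    {b : IterTan n F} → a ∈ tanOver A n → b ∈ tanOver B n → zip n a b ∈ tanOver (A ×ˢ B) n
  | 0, _, _, ha, hb => ⟨ha, hb⟩
  | n + 1, _, _, ha, hb => ⟨zip_mem_tanOver n ha.1 hb.1, mem_univ _⟩

theorem zeroAt_mem_tanOver [AddCommGroup E] {A : Set E} {x : E} (hx : x ∈ A) :
    (n : ℕ) → zeroAt x n ∈ tanOver A n
  | 0 => hx
  | n + 1 => ⟨zeroAt_mem_tanOver hx n, mem_univ _⟩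

theorem map_zip_zip_left : (n : ℕ) → (w : IterTan n X) → (b : IterTan n E) → (c : IterTan n F) →
    map (fun p : X × (E × F) => (p.1, p.2.1)) n (zip n w (zip n b c)) = zip n w b
  | 0, _, _, _ => rfl
  | n + 1, w, b, c => Prod.ext (map_zip_zip_left n w.1 b.1 c.1) (map_zip_zip_left n w.2 b.2 c.2)

theorem map_zip_zip_right [AddCommGroup X] :
    (n : ℕ) → (w : IterTan n X) → (b : IterTan n E) → (c : IterTan n F) →
    map (fun p : X × (E × F) => ((0 : X), p.2.2)) n (zip n w (zip n b c)) = zip n 0 c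
  | 0, _, _, _ => rfl
  | n + 1, w, b, c =>
    Prod.ext (map_zip_zip_right n w.1 b.1 c.1) (map_zip_zip_right n w.2 b.2 c.2)

section Topology

variable [TopologicalSpace E] [TopologicalSpace F]

theorem interior_tanOver (A : Set E) : (n : ℕ) → interior (tanOver A n) = tanOver (interior A) n
  | 0 => rfl
  | n + 1 => by
    refine (interior_prod_eq _ _).trans ?_
    rw [interior_tanOver A n, interior_univ]
    rfl

theorem isOpen_tanOver {A : Set E} (hA : IsOpen A) (n : ℕ) : IsOpen (tanOver A n) := by
  rw [← interior_eq_iff_isOpen, interior_tanOver, hA.interior_eq]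

theorem tanOver_subset_closure_interior {A : Set E} (hA : A ⊆ closure (interior A)) :
    (n : ℕ) → tanOver A n ⊆ closure (interior (tanOver A n))
  | 0 => hA
  | n + 1 => prod_subset_closure_interior_prod (tanOver_subset_closure_interior hA n) isOpen_univ

theorem continuous_map {φ : E → F} (h : Continuous φ) : (n : ℕ) → Continuous (map φ n)
  | 0 => h
  | n + 1 => (continuous_map h n).prodMap (continuous_map h n)

theorem continuous_zip : (n : ℕ) → Continuous fun p : IterTan n E × IterTan n F => zip n p.1 p.2
  | 0 => continuous_id
  | n + 1 =>
    ((continuous_zip n).comp (continuous_fst.prodMap continuous_fst)).prodMk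
      ((continuous_zip n).comp (continuous_snd.prodMap continuous_snd))

end Topology

variable [AddCommGroup E] [Module ℝ E] [AddCommGroup F] [Module ℝ F]

theorem zip_add_smul : (n : ℕ) → (a a' : IterTan n E) → (b b' : IterTan n F) → (t : ℝ) →
    zip n (a + t • a') (b + t • b') = zip n a b + t • zip n a' b'
  | 0, _, _, _, _, _ => rfl
  | n + 1, a, a', b, b', t =>
    Prod.ext (zip_add_smul n a.1 a'.1 b.1 b'.1 t) (zip_add_smul n a.2 a'.2 b.2 b'.2 t)

theorem map_add_smul {φ : E → F} (h : ∀ x v (t : ℝ), φ (x + t • v) = φ x + t • φ v) :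
    (n : ℕ) → (w w' : IterTan n E) → (t : ℝ) → map φ n (w + t • w') = map φ n w + t • map φ n w'
  | 0, w, w', t => h w w' t
  | n + 1, w, w', t => Prod.ext (map_add_smul h n w.1 w'.1 t) (map_add_smul h n w.2 w'.2 t)

end IterTan

open IterTan

/-- The type of sequences of higher differentials `dⁿf : T^n E → F` of maps `f : E → F`. -/
abbrev Tower (E F : Type*) : Type _ := (n : ℕ) → IterTan n E → F

section Tower

variable {E F G : Type*} [AddCommGroup E] [Module ℝ E] [TopologicalSpace E]
  [AddCommGroup F] [Module ℝ F] [TopologicalSpace F]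
  [AddCommGroup G] [Module ℝ G] [TopologicalSpace G]

theorem IsDiffTower.smoothOn {f : E → F} {U : Set E} {d : Tower E F} (h : IsDiffTower f U d) :
    SmoothOn f U := ⟨d, h⟩

theorem IsDiffTower.continuousOn {f : E → F} {U : Set E} {d : Tower E F}
    (h : IsDiffTower f U d) (n : ℕ) : ContinuousOn (d n) (tanOver U n) := (h.succ n).continuousOn

theorem IsDiffTower.prodMk {f : E → F} {g : E → G} {U : Set E} {a : Tower E F} {b : Tower E G}
    (ha : IsDiffTower f U a) (hb : IsDiffTower g U b) :
    IsDiffTower (fun x => (f x, g x)) U (fun n w => (a n w, b n w)) where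
  zero := by rw [ha.zero, hb.zero]; rfl
  succ n := (ha.succ n).prodMk (hb.succ n)

theorem IsDiffTower.add [IsTopologicalAddGroup F] {f g : E → F} {U : Set E} {a b : Tower E F}
    (ha : IsDiffTower f U a) (hb : IsDiffTower g U b) :
    IsDiffTower (fun x => f x + g x) U (fun n w => a n w + b n w) where
  zero := by rw [ha.zero, hb.zero]; rfl
  succ n := (ha.succ n).add (hb.succ n)

theorem IsDiffTower.const_smul [ContinuousConstSMul ℝ F] (t : ℝ) {f : E → F} {U : Set E}
    {d : Tower E F} (h : IsDiffTower f U d) :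
    IsDiffTower (fun x => t • f x) U (fun n w => t • d n w) where
  zero := by rw [h.zero]; rfl
  succ n := (h.succ n).const_smul t

theorem IsDiffTower.clm_comp (L : F →L[ℝ] G) {f : E → F} {U : Set E} {d : Tower E F}
    (h : IsDiffTower f U d) : IsDiffTower (fun x => L (f x)) U (fun n w => L (d n w)) where
  zero := by rw [h.zero]; rfl
  succ n := (h.succ n).clm_comp L

theorem IsDiffTower.comp_clm {f : F → G} {V : Set F} {d : Tower F G} (h : IsDiffTower f V d)
    (L : E →L[ℝ] F) {A : Set E} (hA : MapsTo L A V)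
    (hAi : MapsTo L (interior A) (interior V)) :
    IsDiffTower (fun x => f (L x)) A (fun n w => d n (map L n w)) where
  zero := by rw [h.zero]; rfl
  succ n := (h.succ n).comp_linear (continuous_map L.continuous n)
    (map_add_smul (fun x v t => by simp) n) (map_mem_tanOver hA n) (by
      rw [interior_tanOver, interior_tanOver]; exact map_mem_tanOver hAi n)

section Uniqueness

variable [IsTopologicalAddGroup E] [ContinuousSMul ℝ E]

theorem SmoothOn.congr {f g : E → F} {U : Set E} (h : SmoothOn f U) (hfg : EqOn g f U) :
    SmoothOn g U := by
  obtain ⟨d, hd⟩ := h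
  refine ⟨fun n => match n with | 0 => g | n + 1 => d (n + 1), rfl, fun n => ?_⟩
  cases n with
  | zero => exact (hd.succ 0).congr (by rw [hd.zero]; exact hfg) fun _ _ => rfl
  | succ n => exact hd.succ (n + 1)

variable [T2Space F]

theorem IsDiffTower.eqOn {f g : E → F} {U : Set E} {a b : Tower E F}
    (hU : U ⊆ closure (interior U)) (ha : IsDiffTower f U a) (hb : IsDiffTower g U b)
    (h : EqOn f g U) : (n : ℕ) → EqOn (a n) (b n) (tanOver U n)
  | 0 => by rw [ha.zero, hb.zero]; exact h
  | n + 1 => (ha.succ n).eqOn_diff (tanOver_subset_closure_interior hU n) (hb.succ n)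
      (IsDiffTower.eqOn hU ha hb h n)

theorem IsDiffTower.iterDiff_eqOn {f : E → F} {U : Set E} {d : Tower E F}
    (hU : U ⊆ closure (interior U)) (hd : IsDiffTower f U d) (n : ℕ) :
    EqOn (iterDiff f U n) (d n) (tanOver U n) :=
  hd.smoothOn.isDiffTower.eqOn hU hd (fun _ _ => rfl) n

end Uniqueness

section Symmetry

variable [IsTopologicalAddGroup E] [ContinuousSMul ℝ E] [IsTopologicalAddGroup G]
  [ContinuousSMul ℝ G] [IsTopologicalAddGroup F] [ContinuousSMul ℝ F] [LocallyConvexSpace ℝ F]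
  [T2Space F]

/-- Differentiating `df` in the sense of `HasDiffOn` and by the recursion for `d^(n+1)f` puts the
new tangent vectors in different slots; the symmetry of second differentials exchanges them. -/
theorem IsDiffTower.diff_comp_clm {f : E → F} {U : Set E} {d : Tower E F}
    (hU : U ⊆ closure (interior U)) (hd : IsDiffTower f U d) (P Q : G →L[ℝ] E) {A : Set G}
    (hP : MapsTo P A U) (hPi : MapsTo P (interior A) (interior U)) :
    IsDiffTower (fun z => d 1 (P z, Q z)) A
      (fun n w => d (n + 1) (map P n w, map Q n w)) where
  zero := rfl
  succ n := by
    have hlin (L : G →L[ℝ] E) := map_add_smul (φ := L) (fun x v t => by simp) n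
    have hcomp := (hd.succ (n + 1)).comp_linear (A := tanOver A n)
      (L := fun w : IterTan n G => (map P n w, map Q n w))
      ((continuous_map P.continuous n).prodMk (continuous_map Q.continuous n))
      (fun x v t => Prod.ext (hlin P x v t) (hlin Q x v t))
      (fun w hw => ⟨map_mem_tanOver hP n hw, mem_univ _⟩)
      (by
        rw [interior_tanOver, interior_tanOver]
        exact fun w hw => ⟨map_mem_tanOver hPi n hw, mem_univ _⟩)
    exact hcomp.congr (fun _ _ => rfl) fun w hw =>
      (hd.succ n).diff_diff_comm (tanOver_subset_closure_interior hU n) (hd.succ (n + 1))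
        (map_mem_tanOver hP n hw.1) _ _ _

end Symmetry

end Tower

section Tangent

/-- The higher differentials of the tangent map `(x, v) ↦ (f x, df (x, v))`, in terms of the higher
differentials `h` of `f`. -/
def tangentTower {E F : Type*} (h : Tower E F) : Tower (E × E) (F × F) := fun k w =>
  (h k (map Prod.fst k w), h (k + 1) (map Prod.fst k w, map Prod.snd k w))

/-- The higher differentials of the `n`-th tangent map `T^n f : T^n E → T^n F`, in terms of the
higher differentials of `f`. -/
def iterTangentTower {E F : Type*} : (n : ℕ) → Tower E F → Tower (IterTan n E) (IterTan n F)
  | 0, h => h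
  | n + 1, h => tangentTower (iterTangentTower n h)

/-- The `n`-th tangent map `T^n f : T^n E → T^n F` of a map `f` with higher differentials `h`. -/
def iterTangentMap {E F : Type*} (n : ℕ) (h : Tower E F) (w : IterTan n E) : IterTan n F :=
  iterTangentTower n h 0 w

theorem iterTangentMap_mem_tanOver {E F : Type*} {h : Tower E F} {A : Set E} {B : Set F}
    (hm : MapsTo (h 0) A B) : (n : ℕ) → MapsTo (iterTangentMap n h) (tanOver A n) (tanOver B n)
  | 0, _, hw => hm hw
  | n + 1, _, hw => ⟨iterTangentMap_mem_tanOver hm n hw.1, mem_univ _⟩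

theorem iterTangentTower_prodMk {E F G : Type*} (a : Tower E F) (b : Tower E G) :
    (n k : ℕ) → (w : IterTan k (IterTan n E)) →
    iterTangentTower n (fun k w => (a k w, b k w)) k w =
      zip n (iterTangentTower n a k w) (iterTangentTower n b k w)
  | 0, _, _ => rfl
  | n + 1, _, _ =>
    Prod.ext (iterTangentTower_prodMk a b n _ _) (iterTangentTower_prodMk a b n _ _)

theorem iterTangentTower_add_smul {E F : Type*} [AddCommGroup F] [Module ℝ F] (a b : Tower E F)
    (t : ℝ) : (n k : ℕ) → (w : IterTan k (IterTan n E)) →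
    iterTangentTower n (fun k w => a k w + t • b k w) k w =
      iterTangentTower n a k w + t • iterTangentTower n b k w
  | 0, _, _ => rfl
  | n + 1, _, _ =>
    Prod.ext (iterTangentTower_add_smul a b t n _ _) (iterTangentTower_add_smul a b t n _ _)

theorem iterTangentMap_prodMk {E F G : Type*} (a : Tower E F) (b : Tower E G) (n : ℕ)
    (w : IterTan n E) :
    iterTangentMap n (fun k w => (a k w, b k w)) w =
      zip n (iterTangentMap n a w) (iterTangentMap n b w) :=
  iterTangentTower_prodMk a b n 0 w

theorem iterTangentMap_add_smul {E F : Type*} [AddCommGroup F] [Module ℝ F] (a b : Tower E F)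
    (t : ℝ) (n : ℕ) (w : IterTan n E) :
    iterTangentMap n (fun k w => a k w + t • b k w) w =
      iterTangentMap n a w + t • iterTangentMap n b w :=
  iterTangentTower_add_smul a b t n 0 w

variable {E F : Type*} [AddCommGroup E] [Module ℝ E] [TopologicalSpace E]
  [IsTopologicalAddGroup E] [ContinuousSMul ℝ E]
  [AddCommGroup F] [Module ℝ F] [TopologicalSpace F]
  [IsTopologicalAddGroup F] [ContinuousSMul ℝ F] [LocallyConvexSpace ℝ F] [T2Space F]
  {f : E → F} {A : Set E} {h : Tower E F}

theorem IsDiffTower.tangent (hA : A ⊆ closure (interior A)) (hf : IsDiffTower f A h) :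
    IsDiffTower (tangentTower h 0) (A ×ˢ univ) (tangentTower h) := by
  have hfst : MapsTo Prod.fst (interior (A ×ˢ (univ : Set E))) (interior A) := by
    rw [interior_prod_eq]
    exact fun p hp => hp.1
  have hbase := hf.comp_clm (ContinuousLinearMap.fst ℝ E E) (fun p hp => hp.1) hfst
  have hdiff := hf.diff_comp_clm hA (ContinuousLinearMap.fst ℝ E E)
    (ContinuousLinearMap.snd ℝ E E) (fun p hp => hp.1) hfst
  exact ⟨rfl, (hbase.prodMk hdiff).succ⟩

theorem IsDiffTower.iterTangent (hA : A ⊆ closure (interior A)) (hf : IsDiffTower f A h) :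
    (n : ℕ) → IsDiffTower (iterTangentMap n h) (tanOver A n) (iterTangentTower n h)
  | 0 => ⟨rfl, hf.succ⟩
  | n + 1 => (IsDiffTower.iterTangent hA hf n).tangent (tanOver_subset_closure_interior hA n)

theorem IsDiffTower.continuousOn_iterTangentMap (hA : A ⊆ closure (interior A))
    (hf : IsDiffTower f A h) (n : ℕ) : ContinuousOn (iterTangentMap n h) (tanOver A n) :=
  (hf.iterTangent hA n).continuousOn 0

end Tangent

/-! ### Maps on products -/

section Product

variable {X E F : Type*} [AddCommGroup X] [Module ℝ X] [TopologicalSpace X]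
  [AddCommGroup E] [Module ℝ E] [TopologicalSpace E]
  [AddCommGroup F] [Module ℝ F] [TopologicalSpace F]
  {f : X × E → F} {T : Set X} {U : Set E} {a : Tower (X × E) F}

theorem IsDiffTower.hasDiffOn_zip (hf : IsDiffTower f (T ×ˢ U) a) (n : ℕ) :
    HasDiffOn (fun p : IterTan n X × IterTan n E => a n (zip n p.1 p.2))
      (fun q => a (n + 1) (zip n q.1.1 q.1.2, zip n q.2.1 q.2.2))
      (tanOver T n ×ˢ tanOver U n) := by
  refine (hf.succ n).comp_linear (continuous_zip n) (fun p q t => zip_add_smul n _ _ _ _ t)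
    (fun p hp => zip_mem_tanOver n hp.1 hp.2) fun p hp => ?_
  rw [interior_prod_eq, interior_tanOver, interior_tanOver] at hp
  rw [interior_tanOver, interior_prod_eq]
  exact zip_mem_tanOver n hp.1 hp.2

variable [IsTopologicalAddGroup X] [ContinuousSMul ℝ X]
  [IsTopologicalAddGroup E] [ContinuousSMul ℝ E]
  [IsTopologicalAddGroup F] [ContinuousSMul ℝ F] [LocallyConvexSpace ℝ F]

theorem IsDiffTower.comp_graph [LocallyConvexSpace ℝ E] [T2Space E] {g : X → E} {b : Tower X E}
    (hT : T ⊆ closure (interior T)) (hU : IsOpen U) (hf : IsDiffTower f (T ×ˢ U) a)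
    (hg : IsDiffTower g T b) (hm : MapsTo g T U) :
    IsDiffTower (fun x => f (x, g x)) T (fun n w => a n (zip n w (iterTangentMap n b w))) where
  zero := by
    rw [hf.zero, ← hg.zero]
    rfl
  succ n := by
    have hmn : MapsTo (iterTangentMap n b) (tanOver T n) (tanOver U n) :=
      iterTangentMap_mem_tanOver (by rwa [hg.zero]) n
    refine (hf.hasDiffOn_zip n).comp ((HasDiffOn.id _).prodMk ((hg.iterTangent hT n).succ 0))
      (fun w hw => ⟨hw, hmn hw⟩) ?_
    rw [interior_prod_eq, (isOpen_tanOver hU n).interior_eq]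
    exact fun w hw => ⟨hw, hmn (interior_subset hw)⟩

/-- The higher differentials of the partial differential `(x, y, v) ↦ df ((x, y), (0, v))`, in terms
of the higher differentials `a` of `f`. -/
def sndDiffTower {X E F : Type*} [AddCommGroup X] (a : Tower (X × E) F) : Tower (X × (E × E)) F :=
  fun n w => a (n + 1) (map (fun p => (p.1, p.2.1)) n w, map (fun p => (0, p.2.2)) n w)

theorem sndDiffTower_zip {X E F : Type*} [AddCommGroup X] (a : Tower (X × E) F) (n : ℕ)
    (w : IterTan n X) (b c : IterTan n E) :
    sndDiffTower a n (zip n w (zip n b c)) = a (n + 1) (zip n w b, zip n 0 c) := by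
  rw [sndDiffTower, map_zip_zip_left, map_zip_zip_right]

theorem IsDiffTower.sndDiff [T2Space F] (hT : T ⊆ closure (interior T)) (hU : IsOpen U)
    (hf : IsDiffTower f (T ×ˢ U) a) :
    IsDiffTower (fun p : X × (E × E) => a 1 ((p.1, p.2.1), (0, p.2.2))) (T ×ˢ (U ×ˢ univ))
      (sndDiffTower a) := by
  refine hf.diff_comp_clm (prod_subset_closure_interior_prod hT hU)
    ((ContinuousLinearMap.fst ℝ X (E × E)).prod
      ((ContinuousLinearMap.fst ℝ E E).comp (ContinuousLinearMap.snd ℝ X (E × E))))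
    ((0 : X × (E × E) →L[ℝ] X).prod
      ((ContinuousLinearMap.snd ℝ E E).comp (ContinuousLinearMap.snd ℝ X (E × E))))
    (fun p hp => ⟨hp.1, hp.2.1⟩) ?_
  simp only [interior_prod_eq]
  exact fun p hp => ⟨hp.1, hp.2.1⟩

end Product

/-! ### Convergence on compact sets -/

section CompactConvergence

/-- Compact convergence on `A` of the maps `φ t` to `ψ` as `t` runs along `l`, expressed as joint
convergence in `t` and in a point of a compact subset of `A`, so that no uniform structure on the
target is involved. For continuous maps on `A` this is convergence in the compact-open topology. -/
def TendstoOnCompacts {ι Y F : Type*} [TopologicalSpace Y] [TopologicalSpace F]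
    (φ : ι → Y → F) (l : Filter ι) (ψ : Y → F) (A : Set Y) : Prop :=
  ∀ K ⊆ A, IsCompact K → ∀ y ∈ K,
    Tendsto (fun p : ι × Y => φ p.1 p.2) (l ×ˢ 𝓝[K] y) (𝓝 (ψ y))

namespace TendstoOnCompacts

variable {ι κ Y Z F G : Type*} [TopologicalSpace Y] [TopologicalSpace Z] [TopologicalSpace F]
  [TopologicalSpace G] {φ : ι → Y → F} {l : Filter ι} {ψ : Y → F} {A : Set Y}

theorem congr {φ' : ι → Y → F} {ψ' : Y → F} (h : TendstoOnCompacts φ l ψ A)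
    (hφ : ∀ᶠ i in l, EqOn (φ' i) (φ i) A) (hψ : EqOn ψ' ψ A) : TendstoOnCompacts φ' l ψ' A := by
  intro K hKA hK y hy
  rw [hψ (hKA hy)]
  refine (h K hKA hK y hy).congr' ?_
  filter_upwards [hφ.prod_mk self_mem_nhdsWithin] with p hp
  exact (hp.1 (hKA hp.2)).symm

theorem of_continuousOn (hψ : ContinuousOn ψ A) : TendstoOnCompacts (fun _ => ψ) l ψ A :=
  fun _ hKA _ y hy => ((hψ y (hKA hy)).mono hKA).tendsto.comp tendsto_snd

theorem comp_tendsto (h : TendstoOnCompacts φ l ψ A) {l' : Filter κ} {s : κ → ι}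
    (hs : Tendsto s l' l) : TendstoOnCompacts (fun j => φ (s j)) l' ψ A :=
  fun K hKA hK y hy => (h K hKA hK y hy).comp (hs.prodMap tendsto_id)

theorem comp_continuousOn (h : TendstoOnCompacts φ l ψ A) {q : Z → Y} {B : Set Z}
    (hq : ContinuousOn q B) (hm : MapsTo q B A) :
    TendstoOnCompacts (fun i z => φ i (q z)) l (fun z => ψ (q z)) B := by
  intro K hKB hK z hz
  have hqK : Tendsto q (𝓝[K] z) (𝓝[q '' K] (q z)) :=
    ((hq z (hKB hz)).mono hKB).tendsto_nhdsWithin (mapsTo_image q K)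
  exact (h (q '' K) ((hm.mono_left hKB).image_subset) (hK.image_of_continuousOn (hq.mono hKB))
    (q z) (mem_image_of_mem q hz)).comp (tendsto_id.prodMap hqK)

theorem prodMk {χ : ι → Y → G} {ω : Y → G} (h : TendstoOnCompacts φ l ψ A)
    (h' : TendstoOnCompacts χ l ω A) :
    TendstoOnCompacts (fun i y => (φ i y, χ i y)) l (fun y => (ψ y, ω y)) A :=
  fun K hKA hK y hy => (h K hKA hK y hy).prodMk_nhds (h' K hKA hK y hy)

theorem continuousOn_comp (h : TendstoOnCompacts φ l ψ A) {g : F → G} {B : Set F}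
    (hg : ContinuousOn g B) (hφ : ∀ᶠ i in l, MapsTo (φ i) A B) (hψ : MapsTo ψ A B) :
    TendstoOnCompacts (fun i y => g (φ i y)) l (fun y => g (ψ y)) A := by
  intro K hKA hK y hy
  refine (hg _ (hψ (hKA hy))).tendsto.comp
    (tendsto_nhdsWithin_iff.2 ⟨h K hKA hK y hy, ?_⟩)
  filter_upwards [hφ.prod_mk self_mem_nhdsWithin] with p hp
  exact hp.1 (hKA hp.2)

theorem eventually_forall_mem (h : TendstoOnCompacts φ l ψ A) {K : Set Y} (hKA : K ⊆ A)
    (hK : IsCompact K) {W : Set F} (hW : IsOpen W) (hm : MapsTo ψ K W) :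
    ∀ᶠ i in l, ∀ y ∈ K, φ i y ∈ W := by
  refine hK.induction_on (p := fun s => ∀ᶠ i in l, ∀ y ∈ s, φ i y ∈ W) (by simp)
    (fun s s' hs h => h.mono fun i hi y hy => hi y (hs hy))
    (fun s s' h h' => (h.and h').mono fun i hi y hy => hy.elim (hi.1 y) (hi.2 y)) fun y hy => ?_
  obtain ⟨p, hp, q, hq, H⟩ := eventually_prod_iff.1
    ((h K hKA hK y hy).eventually_mem (hW.mem_nhds (hm hy)))
  exact ⟨{y | q y}, hq, hp.mono fun i hi y hy => H hi hy⟩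

end TendstoOnCompacts

variable {ι Y F : Type*} [TopologicalSpace Y] [TopologicalSpace F]

theorem tendstoOnCompacts_of_tendsto_compactOpen [RegularSpace F] {A : Set Y} {Φ : ι → C(A, F)}
    {g : C(A, F)} {φ : ι → Y → F} {ψ : Y → F} {l : Filter ι} (hφ : ∀ i (a : A), Φ i a = φ i a)
    (hψ : ∀ a : A, g a = ψ a) (h : Tendsto Φ l (𝓝 g)) : TendstoOnCompacts φ l ψ A := by
  have hψc : ContinuousOn ψ A := continuousOn_iff_continuous_domRestrict.2
    (g.continuous.congr hψ)
  intro K hKA hK y hy W hW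
  obtain ⟨D, hD, hDclosed, hDW⟩ := exists_mem_nhds_isClosed_subset (interior_mem_nhds.2 hW)
  have hKD : IsCompact ((Subtype.val ⁻¹' K : Set A) ∩ g ⁻¹' D) := by
    refine IsCompact.inter_right ?_ (hDclosed.preimage g.continuous)
    rwa [Subtype.isCompact_iff, Subtype.image_preimage_coe, inter_eq_right.2 hKA]
  have hmaps := ContinuousMap.tendsto_nhds_compactOpen.1 h _ hKD (interior W) isOpen_interior
    fun a ha => hDW ha.2
  have hD' : ψ ⁻¹' D ∈ 𝓝[K] y := ((hψc y (hKA hy)).mono hKA).tendsto hD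
  refine mem_map.2 ?_
  filter_upwards [hmaps.prod_mk (inter_mem self_mem_nhdsWithin hD')]
  rintro ⟨i, z⟩ ⟨hi, hzK, hzD⟩
  have hmem := interior_subset (hi (x := ⟨z, hKA hzK⟩) ⟨hzK, by rwa [mem_preimage, hψ]⟩)
  rwa [hφ] at hmem

theorem TendstoOnCompacts.tendsto_compactOpen {A : Set Y} {Φ : ι → C(A, F)}
    {g : C(A, F)} {φ : ι → Y → F} {ψ : Y → F} {l : Filter ι} (hφ : ∀ i (a : A), Φ i a = φ i a)
    (hψ : ∀ a : A, g a = ψ a) (h : TendstoOnCompacts φ l ψ A) : Tendsto Φ l (𝓝 g) := by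
  refine ContinuousMap.tendsto_nhds_compactOpen.2 fun K hK W hW hm => ?_
  have hKA : Subtype.val '' K ⊆ A := Subtype.coe_image_subset A K
  filter_upwards [h.eventually_forall_mem hKA (hK.image continuous_subtype_val) hW
    (forall_mem_image.2 fun a ha => hψ a ▸ hm ha)] with i hi a ha
  exact hφ i a ▸ hi a (mem_image_of_mem _ ha)

theorem TendstoOnCompacts.iterTangentTower {X E : Type*} [TopologicalSpace X] [TopologicalSpace E]
    {l : Filter ι} {h : ι → Tower X E} {h₀ : Tower X E} {A : Set X}
    (H : ∀ k, TendstoOnCompacts (fun i => h i k) l (h₀ k) (tanOver A k)) :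
    ∀ n k, TendstoOnCompacts (fun i => iterTangentTower n (h i) k) l (iterTangentTower n h₀ k)
      (tanOver (tanOver A n) k)
  | 0 => H
  | n + 1 => fun k => by
    have hfst := continuous_map (continuous_fst (X := IterTan n X) (Y := IterTan n X)) k
    have hsnd := continuous_map (continuous_snd (X := IterTan n X) (Y := IterTan n X)) k
    have hmaps : MapsTo (map (Prod.fst : IterTan n X × IterTan n X → IterTan n X) k)
        (tanOver (tanOver A n ×ˢ (univ : Set (IterTan n X))) k) (tanOver (tanOver A n) k) :=
      map_mem_tanOver (fun p hp => hp.1) k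
    have ih := TendstoOnCompacts.iterTangentTower H n
    exact ((ih k).comp_continuousOn hfst.continuousOn hmaps).prodMk
      ((ih (k + 1)).comp_continuousOn (hfst.prodMk hsnd).continuousOn
        fun w hw => ⟨hmaps hw, mem_univ _⟩)

theorem HasDiffOn.tendstoOnCompacts_slope_snd {X E F : Type*} [AddCommGroup X] [Module ℝ X]
    [TopologicalSpace X] [IsTopologicalAddGroup X] [ContinuousSMul ℝ X]
    [AddCommGroup E] [Module ℝ E] [TopologicalSpace E] [IsTopologicalAddGroup E]
    [ContinuousSMul ℝ E]
    [AddCommGroup F] [Module ℝ F] [TopologicalSpace F] [IsTopologicalAddGroup F]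
    [ContinuousSMul ℝ F] [LocallyConvexSpace ℝ F]
    {f : X × E → F} {f' : (X × E) × (X × E) → F} {T : Set X} {U : Set E} {g k : X → E}
    (hT : T ⊆ closure (interior T)) (hU : IsOpen U) (hf : HasDiffOn f f' (T ×ˢ U))
    (hg : ContinuousOn g T) (hk : ContinuousOn k T) (hm : MapsTo g T U) :
    TendstoOnCompacts (fun (t : ℝ) x => t⁻¹ • (f (x, g x + t • k x) - f (x, g x))) (𝓝[≠] 0)
      (fun x => f' ((x, g x), (0, k x))) T := by
  intro K hKT _ x hx
  have hid : Tendsto (fun z : X => z) (𝓝[K] x) (𝓝[T] x) := nhdsWithin_mono x hKT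
  have hgk := ((hg x (hKT hx)).mono hKT).tendsto.prodMk ((hk x (hKT hx)).mono hKT).tendsto
  exact (hf.tendsto_slope_snd hT hU (hKT hx) (hm (hKT hx)) (k x)).comp
    (tendsto_id.prodMap (hid.prodMk hgk))

end CompactConvergence

/-! ### The topological vector space `C^∞(M, F)` -/

section SmoothMapSpace

theorem CornerStructure.target_subset_closure_interior {X M : Type*} [AddCommGroup X] [Module ℝ X]
    [TopologicalSpace X] [TopologicalSpace M] (S : CornerStructure X M)
    (e : CornerChart M (cornerSet S.functional)) : e.target ⊆ closure (interior e.target) := by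
  obtain ⟨O, hO, he⟩ := e.target_eq
  rw [he, interior_inter, hO.interior_eq]
  exact fun x hx => hO.inter_closure ⟨hx.1, S.dense_interior hx.2⟩

/-- The higher differentials of the coordinate representation of `γ` in the chart `e`. In contrast
to `SmoothMap.chartDiff`, their domain is all of `T^n X`; only the values over `e.target` matter. -/
noncomputable def localDiff {X M F : Type*} [AddCommGroup X] [Module ℝ X] [TopologicalSpace X]
    [TopologicalSpace M] [AddCommGroup F] [Module ℝ F] [TopologicalSpace F] {P : Set X}
    (e : CornerChart M P) (γ : M → F) : Tower X F :=
  iterDiff (fun x => γ (e.invFun x)) e.target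

namespace SmoothMap

variable {X M E F : Type*} [AddCommGroup X] [Module ℝ X] [TopologicalSpace X] [TopologicalSpace M]
  [AddCommGroup E] [Module ℝ E] [TopologicalSpace E] [IsTopologicalAddGroup E]
  [ContinuousSMul ℝ E]
  [AddCommGroup F] [Module ℝ F] [TopologicalSpace F] [IsTopologicalAddGroup F]
  [ContinuousSMul ℝ F]
  {S : CornerStructure X M} {e : CornerChart M (cornerSet S.functional)}

theorem ext {γ η : SmoothMap S F} (h : ∀ m, γ m = η m) : γ = η := Subtype.ext (funext h)

theorem ofFun_apply {h : M → F} (hh : IsSmooth S h) (m : M) : ofFun S h m = h m :=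
  congrFun (congrArg Subtype.val (dif_pos hh : ofFun S h = ⟨h, hh⟩)) m

theorem isDiffTower_localDiff (γ : SmoothMap S F) (he : e ∈ S.charts) :
    IsDiffTower (fun x => γ (e.invFun x)) e.target (localDiff e γ) :=
  (γ.2 e he).isDiffTower

theorem localDiff_zero_apply (γ : SmoothMap S F) (he : e ∈ S.charts) {m : M} (hm : m ∈ e.source) :
    localDiff e γ 0 (e.toFun m) = γ m := by
  rw [(γ.isDiffTower_localDiff he).zero]
  exact congrArg γ (e.left_inv' hm)

theorem iterTangentMap_localDiff_mem {γ : SmoothMap S F} {U : Set F} (hγ : γ ∈ into S U)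
    (he : e ∈ S.charts) (n : ℕ) :
    MapsTo (iterTangentMap n (localDiff e γ)) (tanOver e.target n) (tanOver U n) :=
  iterTangentMap_mem_tanOver (by
    rw [(γ.isDiffTower_localDiff he).zero]
    exact fun x _ => hγ _) n

theorem tendsto_iff_localDiff {ι : Type*} {Φ : ι → SmoothMap S F} {l : Filter ι}
    {γ : SmoothMap S F} :
    Tendsto Φ l (𝓝 γ) ↔ ∀ e ∈ S.charts, ∀ n,
      TendstoOnCompacts (fun i => localDiff e (Φ i) n) l (localDiff e γ n)
        (tanOver e.target n) := by
  have hnhds : 𝓝 γ = ⨅ (e : S.charts) (n : ℕ), comap (chartDiff e n) (𝓝 (chartDiff e n γ)) :=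
    nhds_iInf.trans (iInf_congr fun e => nhds_iInf.trans (iInf_congr fun n => nhds_induced _ _))
  simp only [hnhds, tendsto_iInf, tendsto_comap_iff, Subtype.forall]
  exact forall₃_congr fun e he n =>
    ⟨tendstoOnCompacts_of_tendsto_compactOpen (fun _ _ => rfl) fun _ => rfl,
      TendstoOnCompacts.tendsto_compactOpen (fun _ _ => rfl) fun _ => rfl⟩

theorem tendstoOnCompacts_localDiff (γ : SmoothMap S F) (he : e ∈ S.charts) (n : ℕ) :
    TendstoOnCompacts (fun η : SmoothMap S F => localDiff e η n) (𝓝 γ) (localDiff e γ n)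
      (tanOver e.target n) :=
  tendsto_iff_localDiff.1 tendsto_id e he n

theorem continuous_eval_const (m : M) : Continuous fun γ : SmoothMap S F => γ m := by
  refine continuous_iff_continuousAt.2 fun γ => ?_
  obtain ⟨e, he, hm⟩ := S.cover m
  have hlim := γ.tendstoOnCompacts_localDiff he 0 {e.toFun m}
    (singleton_subset_iff.2 (e.map_source' hm)) isCompact_singleton _ rfl
  rw [localDiff_zero_apply γ he hm] at hlim
  have hpoint : Tendsto (fun _ : SmoothMap S F => e.toFun m) (𝓝 γ) (𝓝[{e.toFun m}] (e.toFun m)) :=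
    tendsto_const_pure.mono_right (pure_le_nhdsWithin (mem_singleton _))
  exact (hlim.comp (tendsto_id.prodMk hpoint)).congr fun η => localDiff_zero_apply η he hm

instance instT2Space [T2Space F] : T2Space (SmoothMap S F) :=
  .of_injective_continuous (f := fun (γ : SmoothMap S F) (m : M) => γ m) Subtype.val_injective
    (continuous_pi continuous_eval_const)

theorem continuous_eval [LocallyCompactSpace M] :
    Continuous fun p : SmoothMap S F × M => p.1 p.2 := by
  refine continuous_iff_continuousAt.2 fun ⟨γ, m⟩ => ?_
  obtain ⟨e, he, hm⟩ := S.cover m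
  obtain ⟨K, hK, hKe, hKc⟩ := local_compact_nhds (e.isOpen_source.mem_nhds hm)
  have hcont : ContinuousOn e.toFun K := e.continuousOn_toFun.mono hKe
  have hlim := γ.tendstoOnCompacts_localDiff he 0 (e.toFun '' K)
    (image_subset_iff.2 fun x hx => e.map_source' (hKe hx)) (hKc.image_of_continuousOn hcont) _
    (mem_image_of_mem _ (mem_of_mem_nhds hK))
  rw [localDiff_zero_apply γ he hm] at hlim
  have hchart : Tendsto e.toFun (𝓝 m) (𝓝[e.toFun '' K] (e.toFun m)) :=
    tendsto_nhdsWithin_iff.2 ⟨hcont.continuousAt hK,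
      mem_of_superset hK fun x hx => mem_image_of_mem _ hx⟩
  rw [ContinuousAt, nhds_prod_eq]
  refine (hlim.comp (tendsto_id.prodMap hchart)).congr' ?_
  filter_upwards [tendsto_snd.eventually_mem hK] with p hp
  exact localDiff_zero_apply p.1 he (hKe hp)

theorem isOpen_into [CompactSpace M] [LocallyCompactSpace M] {U : Set F} (hU : IsOpen U) :
    IsOpen (into S U) := by
  refine isOpen_iff_mem_nhds.2 fun γ hγ => ?_
  have hnear := isCompact_univ.eventually_forall_of_forall_eventually (x₀ := γ)
    (P := fun (η : SmoothMap S F) (m : M) => η m ∈ U) fun m _ =>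
    (continuous_eval.tendsto (γ, m)).eventually_mem (hU.mem_nhds (hγ m))
  exact hnear.mono fun η hη m => hη m (mem_univ m)

section Calculus

variable [IsTopologicalAddGroup X] [ContinuousSMul ℝ X]

theorem localDiff_eqOn [T2Space F] (γ : SmoothMap S F) {a : Tower X F}
    (ha : IsDiffTower (fun x => γ (e.invFun x)) e.target a) (n : ℕ) :
    EqOn (localDiff e γ n) (a n) (tanOver e.target n) :=
  ha.iterDiff_eqOn (S.target_subset_closure_interior e) n

/-- `chartDiff e n`, as a linear map. -/
noncomputable def chartDiffLinear [T2Space F] (e : S.charts) (n : ℕ) :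
    SmoothMap S F →ₗ[ℝ] C(tanOver e.1.target n, F) where
  toFun := chartDiff e n
  map_add' γ η := ContinuousMap.ext fun w => (γ + η).localDiff_eqOn
    ((γ.isDiffTower_localDiff e.2).add (η.isDiffTower_localDiff e.2)) n w.2
  map_smul' t γ := ContinuousMap.ext fun w => (t • γ).localDiff_eqOn
    ((γ.isDiffTower_localDiff e.2).const_smul t) n w.2

instance instIsTopologicalAddGroup [T2Space F] : IsTopologicalAddGroup (SmoothMap S F) :=
  topologicalAddGroup_iInf fun e => topologicalAddGroup_iInf fun n =>
    topologicalAddGroup_induced (chartDiffLinear e n)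

instance instContinuousSMul [T2Space F] : ContinuousSMul ℝ (SmoothMap S F) :=
  continuousSMul_iInf fun e => continuousSMul_iInf fun n =>
    continuousSMul_induced (chartDiffLinear e n)

theorem localDiff_smul_sub [T2Space F] (γ η : SmoothMap S F) (he : e ∈ S.charts) (t : ℝ) (n : ℕ) :
    EqOn (localDiff e (t • (γ - η) : SmoothMap S F) n)
      (fun w => t • (localDiff e γ n w - localDiff e η n w)) (tanOver e.target n) := fun w hw =>
  DFunLike.congr_fun (f := chartDiffLinear ⟨e, he⟩ n (t • (γ - η)))
    (g := t • (chartDiffLinear ⟨e, he⟩ n γ - chartDiffLinear ⟨e, he⟩ n η))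
    (by rw [map_smul, map_sub]) ⟨w, hw⟩

/-- The smooth map `m ↦ L (γ m)`, for a continuous linear map `L`. -/
def compCLM (L : E →L[ℝ] F) (γ : SmoothMap S E) : SmoothMap S F :=
  ⟨fun m => L (γ m), fun _ he => ((γ.isDiffTower_localDiff he).clm_comp L).smoothOn⟩

theorem continuous_compCLM [T2Space F] (L : E →L[ℝ] F) :
    Continuous (compCLM (S := S) L) := by
  refine continuous_iff_continuousAt.2 fun γ => tendsto_iff_localDiff.2 fun e he n => ?_
  have heq (η : SmoothMap S E) : EqOn (localDiff e (compCLM L η) n)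
      (fun w => L (localDiff e η n w)) (tanOver e.target n) :=
    (compCLM L η).localDiff_eqOn ((η.isDiffTower_localDiff he).clm_comp L) n
  exact ((γ.tendstoOnCompacts_localDiff he n).continuousOn_comp L.continuous.continuousOn
    (Eventually.of_forall fun _ => mapsTo_univ _ _) (mapsTo_univ _ _)).congr
    (Eventually.of_forall heq) (heq γ)

/-- The smooth map `m ↦ (γ m, η m)`. -/
def prodMk (γ : SmoothMap S E) (η : SmoothMap S F) : SmoothMap S (E × F) :=
  ⟨fun m => (γ m, η m), fun _ he =>
    ((γ.isDiffTower_localDiff he).prodMk (η.isDiffTower_localDiff he)).smoothOn⟩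

theorem continuous_prodMk [T2Space E] [T2Space F] :
    Continuous fun p : SmoothMap S E × SmoothMap S F => p.1.prodMk p.2 := by
  refine continuous_iff_continuousAt.2 fun p => tendsto_iff_localDiff.2 fun e he n => ?_
  have heq (q : SmoothMap S E × SmoothMap S F) : EqOn (localDiff e (q.1.prodMk q.2) n)
      (fun w => (localDiff e q.1 n w, localDiff e q.2 n w)) (tanOver e.target n) :=
    (q.1.prodMk q.2).localDiff_eqOn
      ((q.1.isDiffTower_localDiff he).prodMk (q.2.isDiffTower_localDiff he)) n
  exact (((p.1.tendstoOnCompacts_localDiff he n).comp_tendsto continuous_fst.continuousAt).prodMk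
    ((p.2.tendstoOnCompacts_localDiff he n).comp_tendsto continuous_snd.continuousAt)).congr
    (Eventually.of_forall heq) (heq p)

end Calculus

end SmoothMap

end SmoothMapSpace

/-! ### Partial differentials along `M × U` -/

section PartialDifferential

/-- The partial differential `d₂f : M × (U × E) → F`. A limit of difference quotients in `E`, it
does not refer to a chart of `M`; if the limit does not exist, the value is junk. -/
noncomputable def partialSnd {M E F : Type*} [AddCommGroup E] [Module ℝ E]
    [AddCommGroup F] [Module ℝ F] [TopologicalSpace F] (f : M × E → F) : M × (E × E) → F := fun p =>
  limUnder (𝓝[≠] (0 : ℝ)) fun t => t⁻¹ • (f (p.1, p.2.1 + t • p.2.2) - f (p.1, p.2.1))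

/-- The iterated partial differentials `d₂ⁿf : M × (U × E^(2^n-1)) → F`. -/
noncomputable def iterPartialSnd {M E F : Type*} [AddCommGroup E] [Module ℝ E]
    [AddCommGroup F] [Module ℝ F] [TopologicalSpace F] (f : M × E → F) :
    (n : ℕ) → M × IterTan n E → F
  | 0 => f
  | n + 1 => partialSnd (iterPartialSnd f n)

theorem HasDiffOn.partialSnd_eq {M E F : Type*} [AddCommGroup E] [Module ℝ E] [TopologicalSpace E]
    [AddCommGroup F] [Module ℝ F] [TopologicalSpace F] [T2Space F] {f : M × E → F} {U : Set E}
    {m : M} {f' : E × E → F} (hf : HasDiffOn (fun y => f (m, y)) f' U) {y : E}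
    (hy : y ∈ interior U) (v : E) : partialSnd f (m, (y, v)) = f' (y, v) :=
  (hf.tendsto y hy v).limUnder_eq

variable {X M E F : Type*} [AddCommGroup X] [Module ℝ X] [TopologicalSpace X]
  [TopologicalSpace M]
  [AddCommGroup E] [Module ℝ E] [TopologicalSpace E]
  [AddCommGroup F] [Module ℝ F] [TopologicalSpace F]
  {S : CornerStructure X M} {e : CornerChart M (cornerSet S.functional)} {f : M × E → F} {U : Set E}

theorem SmoothOn.isSmoothProd_snd {g : E → F} (hg : SmoothOn g U) :
    IsSmoothProd S (fun p : M × E => g p.2) U := by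
  intro e _
  obtain ⟨d, hd⟩ := hg
  refine (hd.comp_clm (ContinuousLinearMap.snd ℝ X E) (A := e.target ×ˢ U)
    (fun _ hp => hp.2) ?_).smoothOn
  rw [interior_prod_eq]
  exact fun _ hp => hp.2

theorem IsSmoothProd.iterDiffSnd_zero (hf : IsSmoothProd S f U) (he : e ∈ S.charts) {m : M}
    (hm : m ∈ e.source) (y : E) : iterDiffSnd e f U 0 m y = f (m, y) := by
  change iterDiff (chartRep e f) (e.target ×ˢ U) 0 (e.toFun m, y) = _
  rw [(hf e he).isDiffTower.zero]
  exact congrArg (fun m => f (m, y)) (e.left_inv' hm)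

variable [IsTopologicalAddGroup E] [ContinuousSMul ℝ E]
  [IsTopologicalAddGroup F] [ContinuousSMul ℝ F] [LocallyConvexSpace ℝ F]

theorem IsSmoothProd.tendsto_slope_iterDiffSnd (hU : IsOpen U) (hf : IsSmoothProd S f U)
    (he : e ∈ S.charts) {m : M} (hm : m ∈ e.source) {n : ℕ} {w : IterTan n E}
    (hw : w ∈ tanOver U n) (v : IterTan n E) :
    Tendsto (fun t : ℝ => t⁻¹ • (iterDiffSnd e f U n m (w + t • v) - iterDiffSnd e f U n m w))
      (𝓝[≠] 0) (𝓝 (iterDiffSnd e f U (n + 1) m (w, v))) := by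
  have hz := zeroAt_mem_tanOver (e.map_source' hm) n
  have hlim := ((hf e he).isDiffTower.hasDiffOn_zip n).tendsto_slope_snd
    (tanOver_subset_closure_interior (S.target_subset_closure_interior e) n) (isOpen_tanOver hU n)
    hz hw v
  exact hlim.comp (tendsto_id.prodMk ((tendsto_const_pure.mono_right (pure_le_nhdsWithin hz)).prodMk
    (tendsto_const_nhds.prodMk tendsto_const_nhds)))

variable [T2Space F]

theorem IsSmoothProd.iterPartialSnd_eq (hU : IsOpen U) (hf : IsSmoothProd S f U)
    (he : e ∈ S.charts) {m : M} (hm : m ∈ e.source) : (n : ℕ) → {w : IterTan n E} →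
    w ∈ tanOver U n → iterPartialSnd f n (m, w) = iterDiffSnd e f U n m w
  | 0, w, _ => (hf.iterDiffSnd_zero he hm w).symm
  | n + 1, w, hw => by
    have heq : EqOn (fun w => iterPartialSnd f n (m, w)) (iterDiffSnd e f U n m) (tanOver U n) :=
      fun _ => IsSmoothProd.iterPartialSnd_eq hU hf he hm n
    have hw₁ : w.1 ∈ interior (tanOver U n) := by
      rw [(isOpen_tanOver hU n).interior_eq]
      exact hw.1
    exact ((hf.tendsto_slope_iterDiffSnd hU he hm hw.1 w.2).congr'
      (slope_eventuallyEq_of_eqOn heq hw₁ w.2).symm).limUnder_eq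

theorem IsSmoothProd.chartRep_partialSnd_eqOn (hU : IsOpen U) (hf : IsSmoothProd S f U)
    (he : e ∈ S.charts) : EqOn (chartRep e (partialSnd f))
      (fun p => iterDiff (chartRep e f) (e.target ×ˢ U) 1 ((p.1, p.2.1), (0, p.2.2)))
      (e.target ×ˢ (U ×ˢ univ)) := by
  intro p hp
  refine (hf.iterPartialSnd_eq hU he (e.map_target' hp.1) 1 hp.2).trans ?_
  exact congrArg (fun x => iterDiff (chartRep e f) (e.target ×ˢ U) 1 ((x, p.2.1), (0, p.2.2)))
    (e.right_inv' hp.1)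

variable [IsTopologicalAddGroup X] [ContinuousSMul ℝ X]

theorem IsSmoothProd.partialSnd (hU : IsOpen U) (hf : IsSmoothProd S f U) :
    IsSmoothProd S (partialSnd f) (U ×ˢ univ) := fun e he =>
  ((hf e he).isDiffTower.sndDiff (S.target_subset_closure_interior e) hU).smoothOn.congr
    (hf.chartRep_partialSnd_eqOn hU he)

theorem IsSmoothProd.iterPartialSnd (hU : IsOpen U) (hf : IsSmoothProd S f U) :
    (n : ℕ) → IsSmoothProd S (iterPartialSnd f n) (tanOver U n)
  | 0 => hf
  | n + 1 => (IsSmoothProd.iterPartialSnd hU hf n).partialSnd (isOpen_tanOver hU n)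

end PartialDifferential

/-! ### The map `f_♯` -/

section Sharp

variable {X M E F : Type*} [AddCommGroup X] [Module ℝ X] [TopologicalSpace X]
  [IsTopologicalAddGroup X] [ContinuousSMul ℝ X] [TopologicalSpace M]
  [AddCommGroup E] [Module ℝ E] [TopologicalSpace E] [IsTopologicalAddGroup E]
  [ContinuousSMul ℝ E] [LocallyConvexSpace ℝ E] [T2Space E]
  [AddCommGroup F] [Module ℝ F] [TopologicalSpace F] [IsTopologicalAddGroup F]
  [ContinuousSMul ℝ F] [LocallyConvexSpace ℝ F]
  {S : CornerStructure X M} {e : CornerChart M (cornerSet S.functional)} {f : M × E → F} {U : Set E}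

theorem IsSmoothProd.isSmooth_graph (hU : IsOpen U) (hf : IsSmoothProd S f U)
    {γ : SmoothMap S E} (hγ : γ ∈ SmoothMap.into S U) : IsSmooth S fun m => f (m, γ m) :=
  fun e he => ((hf e he).isDiffTower.comp_graph (S.target_subset_closure_interior e) hU
    (γ.isDiffTower_localDiff he) fun _ _ => hγ _).smoothOn

namespace SmoothMap

theorem sharp_apply (hU : IsOpen U) (hf : IsSmoothProd S f U) {γ : SmoothMap S E}
    (hγ : γ ∈ into S U) (m : M) : sharp S f γ m = f (m, γ m) :=
  ofFun_apply (hf.isSmooth_graph hU hγ) m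

variable [T2Space F]

theorem localDiff_sharp_eqOn (hU : IsOpen U) (hf : IsSmoothProd S f U) (he : e ∈ S.charts)
    {k : X × E → F} {a : Tower (X × E) F} (hk : IsDiffTower k (e.target ×ˢ U) a)
    (hfk : EqOn (chartRep e f) k (e.target ×ˢ U)) {γ : SmoothMap S E} (hγ : γ ∈ into S U)
    {b : Tower X E} (hb : IsDiffTower (fun x => γ (e.invFun x)) e.target b) (n : ℕ) :
    EqOn (localDiff e (sharp S f γ) n) (fun w => a n (zip n w (iterTangentMap n b w)))
      (tanOver e.target n) :=
  ((sharp S f γ).isDiffTower_localDiff he).eqOn (S.target_subset_closure_interior e)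
    (hk.comp_graph (S.target_subset_closure_interior e) hU hb fun _ _ => hγ _)
    (fun x hx => (sharp_apply hU hf hγ _).trans (@hfk (x, γ (e.invFun x)) ⟨hx, hγ _⟩)) n

theorem localDiff_sharp_partialSnd_eqOn (hU : IsOpen U) (hf : IsSmoothProd S f U)
    (he : e ∈ S.charts) {γ : SmoothMap S E} (hγ : γ ∈ into S U) (η : SmoothMap S E) (n : ℕ) :
    EqOn (localDiff e (sharp S (partialSnd f) (γ.prodMk η)) n)
      (fun w => iterDiff (chartRep e f) (e.target ×ˢ U) (n + 1)
        (zip n w (iterTangentMap n (localDiff e γ) w),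
          zip n 0 (iterTangentMap n (localDiff e η) w))) (tanOver e.target n) := by
  refine (localDiff_sharp_eqOn (hU.prod isOpen_univ) (hf.partialSnd hU) he
    ((hf e he).isDiffTower.sndDiff (S.target_subset_closure_interior e) hU)
    (hf.chartRep_partialSnd_eqOn hU he) (γ := γ.prodMk η) (fun m => ⟨hγ m, mem_univ _⟩)
    ((γ.isDiffTower_localDiff he).prodMk (η.isDiffTower_localDiff he)) n).trans fun w _ => ?_
  simp only [iterTangentMap_prodMk, sndDiffTower_zip]

theorem continuousOn_sharp (hU : IsOpen U) (hf : IsSmoothProd S f U) :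
    ContinuousOn (sharp S f) (into S U) := by
  refine fun γ hγ => tendsto_iff_localDiff.2 fun e he n => ?_
  have htangent : TendstoOnCompacts (fun η : SmoothMap S E => iterTangentMap n (localDiff e η))
      (𝓝[into S U] γ) (iterTangentMap n (localDiff e γ)) (tanOver e.target n) :=
    (TendstoOnCompacts.iterTangentTower (γ.tendstoOnCompacts_localDiff he) n 0).comp_tendsto
      (tendsto_id'.2 nhdsWithin_le_nhds)
  have hmaps {η : SmoothMap S E} (hη : η ∈ into S U) :
      MapsTo (fun w => (w, iterTangentMap n (localDiff e η) w)) (tanOver e.target n)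
        (tanOver e.target n ×ˢ tanOver U n) :=
    fun w hw => ⟨hw, iterTangentMap_localDiff_mem hη he n hw⟩
  have heq {η : SmoothMap S E} (hη : η ∈ into S U) := localDiff_sharp_eqOn hU hf he
    (hf e he).isDiffTower (fun _ _ => rfl) hη (η.isDiffTower_localDiff he) n
  exact (((TendstoOnCompacts.of_continuousOn continuousOn_id).prodMk htangent).continuousOn_comp
    ((hf e he).isDiffTower.hasDiffOn_zip n).continuousOn
    (eventually_nhdsWithin_of_forall fun _ => hmaps) (hmaps hγ)).congr
    (eventually_nhdsWithin_of_forall fun _ => heq) (heq hγ)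

theorem tendsto_slope_sharp (hU : IsOpen U) (hf : IsSmoothProd S f U) {γ : SmoothMap S E}
    (hγ : γ ∈ interior (into S U)) (η : SmoothMap S E) :
    Tendsto (fun t : ℝ => t⁻¹ • (sharp S f (γ + t • η) - sharp S f γ)) (𝓝[≠] 0)
      (𝓝 (sharp S (partialSnd f) (γ.prodMk η))) := by
  have hγU := interior_subset hγ
  have hline : Tendsto (fun t : ℝ => γ + t • η) (𝓝[≠] 0) (𝓝 γ) := by
    have hcont : Continuous fun t : ℝ => γ + t • η := by fun_prop
    simpa using (hcont.tendsto 0).mono_left nhdsWithin_le_nhds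
  refine tendsto_iff_localDiff.2 fun e he n => ?_
  have hT := S.target_subset_closure_interior e
  have hd := (hf e he).isDiffTower
  have hγd := γ.isDiffTower_localDiff he
  have hηd := η.isDiffTower_localDiff he
  refine ((hd.hasDiffOn_zip n).tendstoOnCompacts_slope_snd (tanOver_subset_closure_interior hT n)
    (isOpen_tanOver hU n) (hγd.continuousOn_iterTangentMap hT n)
    (hηd.continuousOn_iterTangentMap hT n) (iterTangentMap_localDiff_mem hγU he n)).congr ?_
    (localDiff_sharp_partialSnd_eqOn hU hf he hγU η n)
  filter_upwards [hline.eventually_mem (mem_interior_iff_mem_nhds.1 hγ)] with t ht w hw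
  have hnear := localDiff_sharp_eqOn hU hf he hd (fun _ _ => rfl) ht (hγd.add (hηd.const_smul t)) n
    hw
  have hbase := localDiff_sharp_eqOn hU hf he hd (fun _ _ => rfl) hγU hγd n hw
  simp only [iterTangentMap_add_smul] at hnear
  exact (localDiff_smul_sub _ _ he _ n hw).trans
    (congrArg₂ (fun a b => t⁻¹ • (a - b)) hnear hbase)

theorem hasDiffOn_sharp (hU : IsOpen U) (hf : IsSmoothProd S f U) :
    HasDiffOn (sharp S f) (fun p => sharp S (partialSnd f) (p.1.prodMk p.2)) (into S U) where
  continuousOn := continuousOn_sharp hU hf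
  tendsto _ hγ η := tendsto_slope_sharp hU hf hγ η
  continuousOn_diff := (continuousOn_sharp (hU.prod isOpen_univ) (hf.partialSnd hU)).comp
    continuous_prodMk.continuousOn fun _ hp m => ⟨hp.1 m, mem_univ _⟩

end SmoothMap

end Sharp

/-! ### Higher differentials of `f_♯` -/

section HigherDifferentials

variable {X M E F : Type*} [AddCommGroup X] [Module ℝ X] [TopologicalSpace X]
  [TopologicalSpace M]
  [AddCommGroup E] [Module ℝ E] [TopologicalSpace E] [IsTopologicalAddGroup E]
  [ContinuousSMul ℝ E]
  [AddCommGroup F] [Module ℝ F] [TopologicalSpace F] [IsTopologicalAddGroup F]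
  [ContinuousSMul ℝ F] [LocallyConvexSpace ℝ F] [T2Space F]
  {S : CornerStructure X M} {e : CornerChart M (cornerSet S.functional)} {f : M × E → F} {U : Set E}

namespace SmoothMap

/-- The identification of `T^n C^∞(M, E)` with `C^∞(M, T^n E)`. -/
noncomputable def collect : (n : ℕ) → IterTan n (SmoothMap S E) → SmoothMap S (IterTan n E)
  | 0, w => w
  | n + 1, w => (collect n w.1).prodMk (collect n w.2)

theorem collect_apply (m : M) : (n : ℕ) → (w : IterTan n (SmoothMap S E)) →
    collect n w m = IterTan.map (fun γ : SmoothMap S E => γ m) n w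
  | 0, _ => rfl
  | n + 1, w => Prod.ext (collect_apply m n w.1) (collect_apply m n w.2)

theorem collect_add_smul : (n : ℕ) → (w v : IterTan n (SmoothMap S E)) → (t : ℝ) →
    collect n (w + t • v) = collect n w + t • collect n v
  | 0, _, _, _ => rfl
  | n + 1, w, v, t => by
    change (collect n (w.1 + t • v.1)).prodMk (collect n (w.2 + t • v.2)) = _
    rw [collect_add_smul n, collect_add_smul n]
    rfl

theorem collect_mem_into : (n : ℕ) →
    MapsTo (collect n) (tanOver (into S U) n) (into S (tanOver U n))
  | 0, _, hw => hw
  | n + 1, _, hw => fun m => ⟨collect_mem_into n hw.1 m, mem_univ _⟩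

variable [IsTopologicalAddGroup X] [ContinuousSMul ℝ X] [T2Space E]

theorem continuous_collect : (n : ℕ) → Continuous (collect (S := S) (E := E) n)
  | 0 => continuous_id
  | n + 1 => continuous_prodMk.comp (((continuous_collect n).comp continuous_fst).prodMk
      ((continuous_collect n).comp continuous_snd))

theorem collect_mem_interior_into : (n : ℕ) →
    MapsTo (collect n) (tanOver (interior (into S U)) n) (interior (into S (tanOver U n)))
  | 0, _, hw => hw
  | n + 1, w, hw => by
    have heq : into S (tanOver U (n + 1)) =
        compCLM (ContinuousLinearMap.fst ℝ (IterTan n E) (IterTan n E)) ⁻¹'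
          into S (tanOver U n) :=
      Set.ext fun γ => forall_congr' fun m => and_iff_left (mem_univ _)
    rw [heq]
    exact preimage_interior_subset_interior_preimage (continuous_compCLM _)
      (collect_mem_interior_into n hw.1)

variable [LocallyConvexSpace ℝ E]

theorem isDiffTower_sharp (hU : IsOpen U) (hf : IsSmoothProd S f U) :
    IsDiffTower (sharp S f) (into S U) (fun n w => sharp S (iterPartialSnd f n) (collect n w)) where
  zero := rfl
  succ n := by
    refine (hasDiffOn_sharp (isOpen_tanOver hU n) (hf.iterPartialSnd hU n)).comp_linear
      (continuous_collect n) (collect_add_smul n) (collect_mem_into n) ?_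
    rw [interior_tanOver]
    exact collect_mem_interior_into n

theorem iterDiff_sharp_apply (hU : IsOpen U) (hV : into S U ⊆ closure (interior (into S U)))
    (hf : IsSmoothProd S f U) {n : ℕ} {w : IterTan n (SmoothMap S E)}
    (hw : w ∈ tanOver (into S U) n) (he : e ∈ S.charts) {x : M} (hx : x ∈ e.source) :
    iterDiff (sharp S f) (into S U) n w x =
      iterDiffSnd e f U n x (IterTan.map (fun γ : SmoothMap S E => γ x) n w) := by
  have hc := collect_mem_into n hw
  rw [(isDiffTower_sharp hU hf).iterDiff_eqOn hV n hw,
    sharp_apply (isOpen_tanOver hU n) (hf.iterPartialSnd hU n) hc,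
    hf.iterPartialSnd_eq hU he hx n (hc x), collect_apply]

theorem holomorphicOn_sharp [Module ℂ E] [IsScalarTower ℝ ℂ E] [ContinuousSMul ℂ E]
    [Module ℂ F] [IsScalarTower ℝ ℂ F] [ContinuousSMul ℂ F] (hU : IsOpen U)
    (hf : IsSmoothProd S f U) (hh : ∀ m : M, HolomorphicOn (fun y => f (m, y)) U) :
    HolomorphicOn (sharp S f) (into S U) := by
  refine ⟨(isDiffTower_sharp hU hf).smoothOn, _, hasDiffOn_sharp hU hf, fun γ hγ => ?_⟩
  replace hγ := interior_subset hγ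
  have happ (η : SmoothMap S E) (m : M) :
      sharp S (partialSnd f) (γ.prodMk η) m = partialSnd f (m, (γ m, η m)) :=
    sharp_apply (hU.prod isOpen_univ) (hf.partialSnd hU) (γ := γ.prodMk η)
      (fun m => ⟨hγ m, mem_univ _⟩) m
  have hlin (m : M) : IsLinearMap ℂ fun v => partialSnd f (m, (γ m, v)) := by
    obtain ⟨-, f', hf', hl⟩ := hh m
    have hm : γ m ∈ interior U := by rw [hU.interior_eq]; exact hγ m
    simpa only [hf'.partialSnd_eq hm] using hl _ hm
  constructor
  · refine fun η ζ => SmoothMap.ext fun m => (happ _ m).trans ?_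
    exact ((hlin m).map_add (η m) (ζ m)).trans (congrArg₂ (· + ·) (happ η m) (happ ζ m)).symm
  · refine fun c η => SmoothMap.ext fun m => (happ _ m).trans ?_
    exact ((hlin m).map_smul c (η m)).trans (congrArg (c • ·) (happ η m)).symm

end SmoothMap

end HigherDifferentials

theorem mainTheorem4_general
    {X M E F : Type*}
    [AddCommGroup X] [Module ℝ X] [TopologicalSpace X] [IsTopologicalAddGroup X]
    [ContinuousSMul ℝ X] [TopologicalSpace M]
    [AddCommGroup E] [Module ℝ E] [TopologicalSpace E] [IsTopologicalAddGroup E]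
    [ContinuousSMul ℝ E] [LocallyConvexSpace ℝ E] [T2Space E]
    [AddCommGroup F] [Module ℝ F] [TopologicalSpace F] [IsTopologicalAddGroup F]
    [ContinuousSMul ℝ F] [LocallyConvexSpace ℝ F] [T2Space F]
    (S : CornerStructure X M) (U : Set E) (hU : IsOpen U)
    (hV : SmoothMap.into S U ⊆ closure (interior (SmoothMap.into S U))) :
    (∀ f : M × E → F, IsSmoothProd S f U →
      (∀ γ ∈ SmoothMap.into S U, IsSmooth S fun x => f (x, γ x)) ∧
      SmoothOn (SmoothMap.sharp S f) (SmoothMap.into S U) ∧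
      (∀ n : ℕ, ∀ w ∈ IterTan.tanOver (SmoothMap.into S U) n,
        ∀ e ∈ S.charts, ∀ x ∈ e.source,
          iterDiff (SmoothMap.sharp S f) (SmoothMap.into S U) n w x =
            iterDiffSnd e f U n x (IterTan.map (fun γ : SmoothMap S E => γ x) n w)) ∧
      (∀ [Module ℂ E] [IsScalarTower ℝ ℂ E] [ContinuousSMul ℂ E]
        [Module ℂ F] [IsScalarTower ℝ ℂ F] [ContinuousSMul ℂ F],
        (∀ m : M, HolomorphicOn (fun y => f (m, y)) U) →
          HolomorphicOn (SmoothMap.sharp S f) (SmoothMap.into S U))) ∧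
    (∀ g : E → F,
      (SmoothOn g U →
        (∀ γ ∈ SmoothMap.into S U, IsSmooth S fun x => g (γ x)) ∧
        SmoothOn (SmoothMap.pushforward S g) (SmoothMap.into S U)) ∧
      (∀ [Module ℂ E] [IsScalarTower ℝ ℂ E] [ContinuousSMul ℂ E]
        [Module ℂ F] [IsScalarTower ℝ ℂ F] [ContinuousSMul ℂ F],
        HolomorphicOn g U →
          HolomorphicOn (SmoothMap.pushforward S g) (SmoothMap.into S U))) := by
  refine ⟨fun f hf => ⟨fun γ hγ => hf.isSmooth_graph hU hγ,
    (SmoothMap.isDiffTower_sharp hU hf).smoothOn,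
    fun n w hw e he x hx => SmoothMap.iterDiff_sharp_apply hU hV hf hw he hx,
    fun hh => SmoothMap.holomorphicOn_sharp hU hf hh⟩, fun g => ⟨fun hg => ?_, fun hg => ?_⟩⟩
  · exact ⟨fun γ hγ => hg.isSmoothProd_snd.isSmooth_graph hU hγ,
      (SmoothMap.isDiffTower_sharp hU hg.isSmoothProd_snd).smoothOn⟩
  · exact SmoothMap.holomorphicOn_sharp hU hg.1.isSmoothProd_snd fun _ => hg

theorem mainTheorem4
    {X M E F : Type*}
    [AddCommGroup X] [Module ℝ X] [TopologicalSpace X] [IsTopologicalAddGroup X]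
    [ContinuousSMul ℝ X] [LocallyConvexSpace ℝ X] [T2Space X]
    [TopologicalSpace M] [T2Space M] [CompactSpace M]
    [AddCommGroup E] [Module ℝ E] [TopologicalSpace E] [IsTopologicalAddGroup E]
    [ContinuousSMul ℝ E] [LocallyConvexSpace ℝ E] [T2Space E]
    [AddCommGroup F] [Module ℝ F] [TopologicalSpace F] [IsTopologicalAddGroup F]
    [ContinuousSMul ℝ F] [LocallyConvexSpace ℝ F] [T2Space F]
    (S : CornerStructure X M) (U : Set E) (hU : IsOpen U) :
    IsOpen (SmoothMap.into S U) ∧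
    -- the map `f_♯` for smooth `f : M × U → F`
    (∀ f : M × E → F, IsSmoothProd S f U →
      (∀ γ ∈ SmoothMap.into S U, IsSmooth S fun x => f (x, γ x)) ∧
      SmoothOn (SmoothMap.sharp S f) (SmoothMap.into S U) ∧
      (∀ n : ℕ, ∀ w ∈ IterTan.tanOver (SmoothMap.into S U) n,
        ∀ e ∈ S.charts, ∀ x ∈ e.source,
          iterDiff (SmoothMap.sharp S f) (SmoothMap.into S U) n w x =
            iterDiffSnd e f U n x (IterTan.map (fun γ : SmoothMap S E => γ x) n w)) ∧
      (∀ [Module ℂ E] [IsScalarTower ℝ ℂ E] [ContinuousSMul ℂ E]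
        [Module ℂ F] [IsScalarTower ℝ ℂ F] [ContinuousSMul ℂ F],
        (∀ m : M, HolomorphicOn (fun y => f (m, y)) U) →
          HolomorphicOn (SmoothMap.sharp S f) (SmoothMap.into S U))) ∧
    -- the push-forward `g_*` for `g : U → F`
    (∀ g : E → F,
      (SmoothOn g U →
        (∀ γ ∈ SmoothMap.into S U, IsSmooth S fun x => g (γ x)) ∧
        SmoothOn (SmoothMap.pushforward S g) (SmoothMap.into S U)) ∧
      (∀ [Module ℂ E] [IsScalarTower ℝ ℂ E] [ContinuousSMul ℂ E]
        [Module ℂ F] [IsScalarTower ℝ ℂ F] [ContinuousSMul ℂ F],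
        HolomorphicOn g U →
          HolomorphicOn (SmoothMap.pushforward S g) (SmoothMap.into S U))) := by
  have hopen : IsOpen (SmoothMap.into S U) := SmoothMap.isOpen_into hU
  exact ⟨hopen, mainTheorem4_general S U hU (by rw [hopen.interior_eq]; exact subset_closure)⟩
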